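/- Let $d\in\mathbb N_0$. For $X\subseteq\mathbb R^d$ open let $\mathscr D(X)$ be the space of complex-valued smooth functions with compact support in $X$, with its usual (LF) topology, and let $\mathscr D'(X)$ be its dual, with the strong topology (uniform convergence on bounded subsets of $\mathscr D(X)$). A sheaf $\mathscr G$ of distributions on $\mathbb R^d$ defined by local properties assigns to each open $X\subseteq\mathbb R^d$ a linear subspace $\mathscr G(X)\subseteq\mathscr D'(X)$, equipped with the relative topology, such that (1) for open $Y\subseteq X$ the restriction $r_X^Y:\mathscr G(X)\to\mathscr G(Y)$, $u\mapsto u|_{\mathscr D(Y)}$, is well defined; (2) for every open cover $(X_\iota)_\iota$ of $X$ and all $u_\iota\in\mathscr G(X_\iota)$ with $u_\iota=u_\kappa$ on $X_\iota\cap X_\kappa$ for all $\iota,\kappa$ there is $u\in\mathscr G(X)$ with $u|_{X_\iota}=u_\iota$ for all $\iota$ (uniqueness of $u$ is automatic). Let $X\subseteq\mathbb R^d$ be open, let $w\in C^\infty(X)$ be complex-valued, and let $\psi:X\to X$ be smooth and injective with $\det J\psi(x)\neq0$ for all $x\in X$. Then there is a unique continuous linear operator $C_{w,\psi}$ on $\mathscr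 D'(X)$ with $C_{w,\psi}(f)=w\cdot(f\circ\psi)$ for all $f\in C(X)$, where continuous functions on $X$ are regarded as distributions. Let moreover $\mathscr G$ be a sheaf of distributions on $\mathbb R^d$ defined by local properties with $C_{w,\psi}(\mathscr G(X))\subseteq\mathscr G(X)$, and assume the following conditions. a) There is a sequence $(X_n)_{n\in\mathbb N}$ of open sets with union $X$, such that each $\overline{X_n}$ is compact and contained in $X_{n+1}$, and such that for every $n$, every $x\in X\setminus\overline{X_n}$ and every $\varepsilon>0$ with $\overline{B(x,\varepsilon)}\subseteq X\setminus X_n$ the restriction $r_X^{X_n\cup B(x,\varepsilon)}:\mathscr G(X)\to\mathscr G(X_n\cup B(x,\varepsilon))$ has dense range. b) There is $\varepsilon_0>0$ such that for all $\varepsilon\in(0,\varepsilon_0)$ there is $\chi_\varepsilon\in\mathscr D(B(0,\varepsilon))$ such that for all $x\in X$ with $\overline{B(x,\varepsilon)}\subseteq X$ there is $h\in\mathscr G(B(x,\varepsilon))$ with $\langle h,\chi_\varepsilon(\cdot-x)\rangle\neq0$. c) For every $l\in\mathbb N_0$ the set $\{x\in X:\ w(\psi^l(x))\neq0\}$ is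 dense in $X$. Then the following are equivalent: (i) $C_{w,\psi}$ is topologizable on $\mathscr G(X)$, i.e. for every continuous seminorm $p$ on $\mathscr G(X)$ there is a continuous seminorm $q$ on $\mathscr G(X)$ such that for every $m\in\mathbb N$ there is $\gamma_m>0$ with $p(C_{w,\psi}^m(u))\le\gamma_m\,q(u)$ for all $u\in\mathscr G(X)$; (ii) $\psi$ has stable orbits, i.e. for every compact $K\subseteq X$ there is a compact $L\subseteq X$ with $\psi^m(K)\subseteq L$ for all $m\in\mathbb N$. -/

import Mathlib

open TopologicalSpace
open scoped Distributions ContDiff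

noncomputable section

namespace DistSheaf

/-- The space `ℝ^d` with its Euclidean norm. -/
abbrev Eucl (d : ℕ) : Type := EuclideanSpace ℝ (Fin d)

/-- The space `𝒟'(X)` of complex distributions on `X`: the continuous `ℂ`-linear functionals on
the complex test functions `𝒟(X)` (with the usual LF topology). Mathlib's topology on
`_ →L[ℂ] ℂ` is uniform convergence on bounded sets, i.e. the strong dual topology. -/
abbrev Distr {d : ℕ} (X : Opens (Eucl d)) : Type := 𝓓(X, ℂ) →L[ℂ] ℂ

/-- The open Euclidean ball as an element of `Opens`. -/
def ball {d : ℕ} (x : Eucl d) (ε : ℝ) : Opens (Eucl d) := ⟨Metric.ball x ε, Metric.isOpen_ball⟩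

/-- The restriction `u ↦ u|_Y` to `𝒟(Y)` for `Y ⊆ X` (only used for `Y ⊆ X`). -/
def restrict {d : ℕ} {X : Opens (Eucl d)} (Y : Opens (Eucl d)) (u : Distr X) : Distr Y :=
  u.comp (TestFunction.monoCLM ℂ)

/-- The distribution `φ ↦ ∫ φ f` given by a continuous function `f` on `X`
(only used for such `f`). -/
def ofFun {d : ℕ} (X : Opens (Eucl d)) (f : Eucl d → ℂ) : Distr X :=
  TestFunction.integralAgainstBilinCLM (ContinuousLinearMap.mul ℂ ℂ) MeasureTheory.volume f

/-- The translate `τ_x χ (y) = χ (y - x)` of `χ ∈ 𝒟(B(0,ε))`, an element of `𝒟(B(x,ε))`. -/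
def translate {d : ℕ} (x : Eucl d) {ε : ℝ} (χ : 𝓓(ball (0 : Eucl d) ε, ℂ)) :
    𝓓(ball x ε, ℂ) where
  toFun y := χ (y - x)
  contDiff' := χ.contDiff.comp (contDiff_id.sub contDiff_const)
  hasCompactSupport' := χ.hasCompactSupport.comp_homeomorph (Homeomorph.subRight x)
  tsupport_subset' := by
    intro y hy
    have h : y - x ∈ tsupport χ :=
      tsupport_comp_subset_preimage χ (f := fun y => y - x) (by fun_prop) hy
    have h' : y - x ∈ Metric.ball (0 : Eucl d) ε := χ.tsupport_subset h
    change y ∈ Metric.ball x ε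
    rwa [mem_ball_zero_iff, ← mem_ball_iff_norm] at h'

/-- A sheaf of distributions on `ℝ^d` defined by local properties. The localization (uniqueness)
axiom is not listed since it holds automatically for subspaces of `𝒟'(X)`. Each `G.obj X` carries
the subspace topology of `𝒟'(X)`. -/
structure SheafOfDistributions (d : ℕ) where
  obj : (X : Opens (Eucl d)) → Submodule ℂ (Distr X)
  restrict_mem : ∀ {X Y : Opens (Eucl d)}, Y ≤ X → ∀ u ∈ obj X, restrict Y u ∈ obj Y
  gluing : ∀ (X : Opens (Eucl d)) {ι : Type} (U : ι → Opens (Eucl d)), ⨆ i, U i = X →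
    ∀ u : (i : ι) → Distr (U i), (∀ i, u i ∈ obj (U i)) →
      (∀ i j, restrict (U i ⊓ U j) (u i) = restrict (U i ⊓ U j) (u j)) →
      ∃ v ∈ obj X, ∀ i, restrict (U i) v = u i

/-- The restriction map `r_X^Y : G(X) → G(Y)`. -/
def SheafOfDistributions.res {d : ℕ} (G : SheafOfDistributions d) {X Y : Opens (Eucl d)}
    (h : Y ≤ X) (u : G.obj X) : G.obj Y :=
  ⟨restrict Y u.1, G.restrict_mem h u.1 u.2⟩

/-- `C` is a continuous linear operator on `𝒟'(X)` which extends the weighted composition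
operator `f ↦ w · (f ∘ ψ)` on `C(X)`. -/
def IsWeightedCompositionOperator {d : ℕ} (X : Opens (Eucl d)) (w : Eucl d → ℂ)
    (ψ : Eucl d → Eucl d) (C : Distr X →L[ℂ] Distr X) : Prop :=
  ∀ f : Eucl d → ℂ, ContinuousOn f X → C (ofFun X f) = ofFun X (fun x => w x * f (ψ x))

/-- Topologizable operators on a locally convex space. -/
def IsTopologizable {E : Type*} [AddCommGroup E] [Module ℂ E] [TopologicalSpace E]
    (T : E →L[ℂ] E) : Prop :=
  ∀ p : Seminorm ℂ E, Continuous p → ∃ q : Seminorm ℂ E, Continuous q ∧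
    ∀ m : ℕ, 1 ≤ m → ∃ γ : ℝ, 0 < γ ∧ ∀ x : E, p ((T ^ m) x) ≤ γ * q x

/-- The self-map `ψ` of `X` has stable orbits. -/
def HasStableOrbits {d : ℕ} (X : Opens (Eucl d)) (ψ : Eucl d → Eucl d) : Prop :=
  ∀ K : Set (Eucl d), IsCompact K → K ⊆ X →
    ∃ L : Set (Eucl d), IsCompact L ∧ L ⊆ X ∧ ∀ m : ℕ, 1 ≤ m → ψ^[m] '' K ⊆ L

/-- `(X_n)` is an open, relatively compact exhaustion of `X`. -/
structure IsExhaustion {d : ℕ} (X : Opens (Eucl d)) (Xn : ℕ → Opens (Eucl d)) : Prop where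
  isCompact_closure : ∀ n, IsCompact (closure (Xn n : Set (Eucl d)))
  closure_subset : ∀ n, closure (Xn n : Set (Eucl d)) ⊆ Xn (n + 1)
  iSup_eq : ⨆ n, Xn n = X

/-- Condition a): density of the ranges of certain restrictions. -/
def ConditionA {d : ℕ} (G : SheafOfDistributions d) (X : Opens (Eucl d)) : Prop :=
  ∃ Xn : ℕ → Opens (Eucl d), IsExhaustion X Xn ∧
    ∀ n : ℕ, ∀ x ∈ (X : Set (Eucl d)) \ closure (Xn n : Set (Eucl d)), ∀ ε : ℝ, 0 < ε →
      closure (Metric.ball x ε) ⊆ (X : Set (Eucl d)) \ (Xn n : Set (Eucl d)) →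
        ∀ h : Xn n ⊔ ball x ε ≤ X, DenseRange (G.res h)

/-- Condition b): nondegenerate local elements. -/
def ConditionB {d : ℕ} (G : SheafOfDistributions d) (X : Opens (Eucl d)) : Prop :=
  ∃ ε₀ : ℝ, 0 < ε₀ ∧ ∀ ε : ℝ, 0 < ε → ε < ε₀ →
    ∃ χ : 𝓓(ball (0 : Eucl d) ε, ℂ), ∀ x ∈ X, closure (Metric.ball x ε) ⊆ X →
      ∃ h ∈ G.obj (ball x ε), h (translate x χ) ≠ 0

/-- Condition c): each `w ∘ ψ^l` is nonzero on a dense subset of `X`. -/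
def ConditionC {d : ℕ} (X : Opens (Eucl d)) (w : Eucl d → ℂ) (ψ : Eucl d → Eucl d) : Prop :=
  ∀ l : ℕ, (X : Set (Eucl d)) ⊆ closure {x | x ∈ X ∧ w (ψ^[l] x) ≠ 0}

/-- The restriction of an operator on `𝒟'(X)` to an invariant subspace. -/
def restrictOp {d : ℕ} {X : Opens (Eucl d)} (C : Distr X →L[ℂ] Distr X)
    (V : Submodule ℂ (Distr X)) (h : ∀ u ∈ V, C u ∈ V) : V →L[ℂ] V :=
  (C.comp V.subtypeL).codRestrict V (fun u => h u.1 u.2)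

end DistSheaf

end

/-!
The transpose of `C_{w,ψ}` is the operator on test functions sending `φ` to the density obtained
from `φ · w` by the change of variables `y = ψ x`; it moves supports along `ψ`. Topologizability is
an estimate between the seminorms `sup_{φ ∈ B} |u φ|`, `B ⊆ 𝒟(X)` bounded.

If the orbits are stable, all iterated images of a bounded set `A` under the transpose `T` live on
one compact set, and in the metrizable step `𝒟_L` the countably many bounded sets `T ^ m A` can be
scaled to have a bounded union. If the orbits are not stable, the transpose carries test functions
supported in a fixed compact set outside every member of the exhaustion. A local section glued
with `0` and approximated by global sections then violates every candidate estimate.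
-/

noncomputable section

namespace DistSheaf

open Set Filter Bornology Topology MeasureTheory
open scoped BoundedContinuousFunction Convolution

/-! ### Seminorms of the strong dual -/

section StrongDual

variable {𝕜 V : Type*} [NontriviallyNormedField 𝕜] [AddCommGroup V] [Module 𝕜 V]
  [TopologicalSpace V]

theorem bddAbove_range_norm_apply {B : Set V} (hB : IsVonNBounded 𝕜 B) (u : V →L[𝕜] 𝕜) :
    BddAbove (range fun φ : B => ‖u φ‖) := by
  obtain ⟨r, hr⟩ := (NormedSpace.isVonNBounded_iff' 𝕜).1 (hB.image u)
  exact ⟨r, forall_mem_range.2 fun φ => hr _ (mem_image_of_mem u φ.2)⟩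

/-- The seminorm `u ↦ sup_{φ ∈ B} ‖u φ‖` on the dual of `V`, for a bounded set `B ⊆ V`. These
seminorms generate the strong topology; for `B = ∅` the supremum is the junk value `0`. -/
def supSeminorm (B : {B : Set V // IsVonNBounded 𝕜 B}) : Seminorm 𝕜 (V →L[𝕜] 𝕜) :=
  Seminorm.of (fun u => ⨆ φ : B.1, ‖u φ‖)
    (fun u v => Real.iSup_le
      (fun φ => (norm_add_le _ _).trans (add_le_add (le_ciSup (bddAbove_range_norm_apply B.2 u) φ)
        (le_ciSup (bddAbove_range_norm_apply B.2 v) φ)))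
      (add_nonneg (Real.iSup_nonneg fun _ => norm_nonneg _)
        (Real.iSup_nonneg fun _ => norm_nonneg _)))
    (fun c u => by
      simp only [smul_apply, norm_smul]
      exact (Real.mul_iSup_of_nonneg (norm_nonneg c) _).symm)

theorem norm_apply_le_supSeminorm (B : {B : Set V // IsVonNBounded 𝕜 B}) (u : V →L[𝕜] 𝕜)
    {φ : V} (hφ : φ ∈ B.1) : ‖u φ‖ ≤ supSeminorm B u :=
  le_ciSup (bddAbove_range_norm_apply B.2 u) ⟨φ, hφ⟩

theorem supSeminorm_le {B : {B : Set V // IsVonNBounded 𝕜 B}} {u : V →L[𝕜] 𝕜} {r : ℝ}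
    (hr : 0 ≤ r) (h : ∀ φ ∈ B.1, ‖u φ‖ ≤ r) : supSeminorm B u ≤ r :=
  Real.iSup_le (fun φ => h φ φ.2) hr

theorem supSeminorm_mono {A B : {B : Set V // IsVonNBounded 𝕜 B}} (h : A ≤ B) :
    supSeminorm A ≤ supSeminorm B := fun u =>
  supSeminorm_le (apply_nonneg _ _) fun _ hφ => norm_apply_le_supSeminorm B u (h hφ)

theorem supSeminorm_comp {W : Type*} [AddCommGroup W] [Module 𝕜 W] [TopologicalSpace W]
    (B : {B : Set W // IsVonNBounded 𝕜 B}) (L : W →L[𝕜] V) (u : V →L[𝕜] 𝕜) :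
    supSeminorm B (u.comp L) = supSeminorm ⟨L '' B.1, B.2.image L⟩ u :=
  le_antisymm
    (supSeminorm_le (apply_nonneg _ _) fun _ hφ =>
      norm_apply_le_supSeminorm ⟨L '' B.1, _⟩ u (mem_image_of_mem L hφ))
    (supSeminorm_le (apply_nonneg _ _) (forall_mem_image.2 fun _ hφ =>
      norm_apply_le_supSeminorm B (u.comp L) hφ))

theorem continuous_supSeminorm (B : {B : Set V // IsVonNBounded 𝕜 B}) :
    Continuous (supSeminorm B) := by
  refine Seminorm.continuous (r := 2) (mem_of_superset
    ((ContinuousLinearMap.hasBasis_nhds_zero_of_basis Metric.nhds_basis_closedBall).mem_of_mem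
      (i := (B.1, 1)) ⟨B.2, one_pos⟩) fun u hu => ?_)
  rw [Seminorm.mem_ball_zero]
  refine (supSeminorm_le zero_le_one fun φ hφ => ?_).trans_lt one_lt_two
  exact mem_closedBall_zero_iff.1 (hu φ hφ)

theorem withSeminorms_supSeminorm : WithSeminorms (supSeminorm (𝕜 := 𝕜) (V := V)) := by
  refine (SeminormFamily.withSeminorms_iff_nhds_eq_iInf _).2 (le_antisymm ?_ ?_)
  · refine le_iInf fun B => Tendsto.le_comap ?_
    simpa using (continuous_supSeminorm B).tendsto 0
  · refine (ContinuousLinearMap.hasBasis_nhds_zero_of_basis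
      Metric.nhds_basis_closedBall).ge_iff.2 fun ⟨B, ε⟩ ⟨hB, hε⟩ => mem_iInf_of_mem ⟨B, hB⟩ ?_
    refine mem_of_superset (preimage_mem_comap (Iio_mem_nhds hε)) fun u hu φ hφ => ?_
    exact mem_closedBall_zero_iff.2 ((norm_apply_le_supSeminorm ⟨B, hB⟩ u hφ).trans hu.le)

theorem exists_finset_sup_supSeminorm_le (s : Finset {B : Set V // IsVonNBounded 𝕜 B}) :
    ∃ B : {B : Set V // IsVonNBounded 𝕜 B}, s.sup supSeminorm ≤ supSeminorm B :=
  ⟨⟨⋃ A ∈ s, A.1, (isVonNBounded_biUnion s.finite_toSet).2 fun A _ => A.2⟩,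
    Finset.sup_le fun _ hA => supSeminorm_mono (subset_biUnion_of_mem (u := Subtype.val) hA)⟩

theorem mem_closure_of_forall_supSeminorm_le {S : Set (V →L[𝕜] 𝕜)} {u : V →L[𝕜] 𝕜}
    (h : ∀ (B : {B : Set V // IsVonNBounded 𝕜 B}) (r : ℝ), 0 < r →
      ∃ v ∈ S, supSeminorm B (v - u) ≤ r) : u ∈ closure S := by
  refine mem_closure_iff_nhds.2 fun U hU => ?_
  obtain ⟨s, r, hr, hsU⟩ := (withSeminorms_supSeminorm.mem_nhds_iff u U).1 hU
  obtain ⟨B, hB⟩ := exists_finset_sup_supSeminorm_le s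
  obtain ⟨v, hvS, hv⟩ := h B (r / 2) (half_pos hr)
  exact ⟨v, hsU ((Seminorm.mem_ball _).2 ((hB _).trans_lt (hv.trans_lt (half_lt_self hr)))), hvS⟩

theorem exists_le_smul_supSeminorm {S : Submodule 𝕜 (V →L[𝕜] 𝕜)} (p : Seminorm 𝕜 S)
    (hp : Continuous p) :
    ∃ (B : {B : Set V // IsVonNBounded 𝕜 B}) (c : NNReal), ∀ u : S, p u ≤ c * supSeminorm B u := by
  obtain ⟨s, c, -, hpc⟩ := Seminorm.bound_of_continuous
    (LinearMap.withSeminorms_induced withSeminorms_supSeminorm S.subtype) p hp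
  obtain ⟨B, hB⟩ := exists_finset_sup_supSeminorm_le s
  refine ⟨B, c, fun u => (hpc u).trans (mul_le_mul_of_nonneg_left (le_trans ?_ (hB u)) c.2)⟩
  exact Seminorm.finset_sup_apply_le (apply_nonneg _ _) fun A hA =>
    Seminorm.le_finset_sup_apply (p := supSeminorm) (x := u.1) hA

end StrongDual

/-! ### Bounded sets of test functions -/

section BoundedSets

variable {𝕜 V : Type*} [RCLike 𝕜] [AddCommGroup V] [Module 𝕜 V] [TopologicalSpace V]

/-- Mackey's countability condition for metrizable locally convex spaces. The factor `c m` takes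
care of the first `m + 1` seminorms on `A m`. -/
theorem exists_isVonNBounded_iUnion_smul {p : SeminormFamily 𝕜 V ℕ} (hp : WithSeminorms p)
    {A : ℕ → Set V} (hA : ∀ m, IsVonNBounded 𝕜 (A m)) :
    ∃ c : ℕ → ℝ, (∀ m, 0 < c m) ∧ IsVonNBounded 𝕜 (⋃ m, (fun f => (c m : 𝕜) • f) '' A m) := by
  simp_rw [hp.isVonNBounded_iff_seminorm_bounded] at hA ⊢
  choose r hr hrA using hA
  have hsum (m : ℕ) : 0 < ∑ i ∈ Finset.range (m + 1), r m i :=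
    Finset.sum_pos (fun i _ => hr m i) ⟨0, by simp⟩
  refine ⟨fun m => (∑ i ∈ Finset.range (m + 1), r m i)⁻¹, fun m => inv_pos.2 (hsum m), fun i => ?_⟩
  have hle (m : ℕ) (hm : i ≤ m) : (∑ j ∈ Finset.range (m + 1), r m j)⁻¹ * r m i ≤ 1 :=
    inv_mul_le_one_of_le₀ (Finset.single_le_sum (f := r m) (fun j _ => (hr m j).le)
      (Finset.mem_range.2 (Nat.lt_succ_of_le hm))) (hsum m).le
  obtain ⟨R, hR⟩ := IsBoundedUnder.bddAbove_range
    (isBoundedUnder_of_eventually_le (eventually_atTop.2 ⟨i, hle⟩))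
  have hRm (m : ℕ) : (∑ j ∈ Finset.range (m + 1), r m j)⁻¹ * r m i ≤ R := hR (mem_range_self m)
  refine ⟨R, (mul_pos (inv_pos.2 (hsum 0)) (hr 0 i)).trans_le (hRm 0), ?_⟩
  simp only [mem_iUnion, mem_image]
  rintro _ ⟨m, f, hf, rfl⟩
  rw [map_smul_eq_mul, RCLike.norm_of_nonneg (inv_pos.2 (hsum m)).le]
  exact (mul_lt_mul_of_pos_left (hrA m i f hf) (inv_pos.2 (hsum m))).trans_le (hRm m)

variable {E F : Type*} [NormedAddCommGroup E] [NormedSpace ℝ E] {Ω : Opens E}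
  [NormedAddCommGroup F] [NormedSpace ℝ F] [NormedSpace 𝕜 F] [IsScalarTower ℝ 𝕜 F] {n : ℕ∞}

instance continuousSMul_testFunction : ContinuousSMul 𝕜 𝓓^{n}(Ω, F) where
  continuous_smul := by
    have hdecomp (c : 𝕜) (φ : 𝓓^{n}(Ω, F)) :
        c • φ = RCLike.re c • φ + RCLike.im c • ((RCLike.I : 𝕜) • φ) := by
      ext x
      simp only [add_apply, smul_apply]
      conv_lhs => rw [← RCLike.re_add_im c]
      rw [add_smul, mul_smul, RCLike.real_smul_eq_coe_smul (K := 𝕜),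
        RCLike.real_smul_eq_coe_smul (K := 𝕜)]
    have hI : Continuous fun φ : 𝓓^{n}(Ω, F) => (RCLike.I : 𝕜) • φ :=
      (TestFunction.postcompCLM ((RCLike.I : 𝕜) • ContinuousLinearMap.id 𝕜 F)).continuous.congr
        fun φ => by ext x; rw [TestFunction.postcompCLM_apply]; rfl
    have hsum : Continuous fun q : 𝕜 × 𝓓^{n}(Ω, F) =>
        RCLike.re q.1 • q.2 + RCLike.im q.1 • ((RCLike.I : 𝕜) • q.2) :=
      ((RCLike.continuous_re.comp continuous_fst).smul continuous_snd).add
        ((RCLike.continuous_im.comp continuous_fst).smul (hI.comp continuous_snd))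
    exact hsum.congr fun q => (hdecomp q.1 q.2).symm

theorem exists_compact_exhaustion [FiniteDimensional ℝ E] (Ω : Opens E) :
    ∃ K : ℕ → Compacts E, Monotone K ∧ (∀ n, (K n : Set E) ⊆ Ω) ∧
      ∀ L : Set E, IsCompact L → L ⊆ Ω → ∃ n, L ⊆ K n := by
  have : LocallyCompactSpace Ω := Ω.isOpen.locallyCompactSpace
  let c : CompactExhaustion Ω := default
  refine ⟨fun n => ⟨Subtype.val '' c n, (c.isCompact n).image continuous_subtype_val⟩,
    fun m n h => image_mono (c.subset h), fun n => Subtype.coe_image_subset _ _,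
    fun L hL hLΩ => ?_⟩
  have hL' : IsCompact (Subtype.val ⁻¹' L : Set Ω) :=
    (IsInducing.subtypeVal.isCompact_preimage_iff (by simpa using hLΩ)).2 hL
  obtain ⟨n, hn⟩ := c.exists_superset_of_isCompact hL'
  exact ⟨n, fun x hx => ⟨⟨x, hLΩ hx⟩, hn hx, rfl⟩⟩

/-- Along a sequence that leaves every compact subset of `Ω` only finitely many terms are nonzero,
uniformly on each `𝓓_K`, so that arbitrary weights are allowed. -/
theorem exists_continuousLinearMap_smul_eval {x : ℕ → E}
    (hx : ∀ L : Set E, IsCompact L → L ⊆ Ω → ∃ N, ∀ k, x k ∈ L → k < N) (a : ℕ → ℝ) :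
    ∃ S : 𝓓^{n}(Ω, F) →L[𝕜] (ℕ →ᵇ F), ∀ φ k, S φ k = a k • φ (x k) := by
  have hbound {L : Set E} (hL : IsCompact L) (hLΩ : L ⊆ Ω) : ∃ C, 0 ≤ C ∧ ∀ (f : E → F) (b : ℝ),
      0 ≤ b → (∀ y, ‖f y‖ ≤ b) → (∀ y ∉ L, f y = 0) → ∀ k, ‖a k • f (x k)‖ ≤ C * b := by
    obtain ⟨N, hN⟩ := hx L hL hLΩ
    refine ⟨∑ k ∈ Finset.range N, |a k|, by positivity, fun f b hb hfb hf k => ?_⟩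
    by_cases hk : x k ∈ L
    · rw [norm_smul, Real.norm_eq_abs]
      gcongr
      · exact Finset.single_le_sum (f := fun k => |a k|) (fun _ _ => abs_nonneg _)
          (Finset.mem_range.2 (hN k hk))
      · exact hfb _
    · rw [hf _ hk, smul_zero, norm_zero]
      positivity
  have hbdd (φ : 𝓓^{n}(Ω, F)) : ∃ C, ∀ k, ‖a k • φ (x k)‖ ≤ C := by
    obtain ⟨C, -, hC⟩ := hbound φ.hasCompactSupport φ.tsupport_subset
    obtain ⟨b, hb⟩ := φ.continuous.bounded_above_of_compact_support φ.hasCompactSupport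
    exact ⟨C * b, hC φ b ((norm_nonneg _).trans (hb 0)) hb
      fun _ => image_eq_zero_of_notMem_tsupport⟩
  let S (φ : 𝓓^{n}(Ω, F)) : ℕ →ᵇ F := .ofNormedAddCommGroupDiscrete
    (fun k => a k • φ (x k)) (hbdd φ).choose (hbdd φ).choose_spec
  have hadd (φ θ) : S (φ + θ) = S φ + S θ := by
    ext k; exact smul_add _ _ _
  have hsmul (c : 𝕜) (φ) : S (c • φ) = c • S φ := by
    ext k; exact smul_comm _ _ _
  refine ⟨TestFunction.mkCLM 𝕜 S hadd hsmul fun K hK => ?_, fun _ _ => rfl⟩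
  obtain ⟨C, hC0, hC⟩ := hbound K.isCompact hK
  refine (ContDiffMapSupportedIn.mkCLMtoNormedSpace 𝕜 (S ∘ TestFunction.ofSupportedIn hK)
    (fun f g => hadd (.ofSupportedIn hK f) (.ofSupportedIn hK g))
    (fun c f => hsmul c (.ofSupportedIn hK f)) ⟨{0}, C, hC0, fun f => ?_⟩).continuous
  rw [Finset.sup_singleton, BoundedContinuousFunction.norm_le (by positivity)]
  exact hC f _ (apply_nonneg _ _)
    (fun y => ContDiffMapSupportedIn.norm_apply_le_seminorm 𝕜) fun _ hy => f.zero_on_compl hy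

theorem exists_forall_support_subset_of_isVonNBounded [FiniteDimensional ℝ E]
    {B : Set 𝓓^{n}(Ω, F)} (hB : IsVonNBounded 𝕜 B) :
    ∃ K : Compacts E, (K : Set E) ⊆ Ω ∧ ∀ φ ∈ B, Function.support φ ⊆ K := by
  obtain ⟨K, hKmono, hKΩ, hK⟩ := exists_compact_exhaustion Ω
  by_contra! hB_not
  have hpoint (k : ℕ) : ∃ φ ∈ B, ∃ x, φ x ≠ 0 ∧ x ∉ K k := by
    obtain ⟨φ, hφ, hφK⟩ := hB_not (K k) (hKΩ k)
    obtain ⟨x, hx⟩ := not_subset.1 hφK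
    exact ⟨φ, hφ, x, hx⟩
  choose φ hφB x hφx hxK using hpoint
  have hx (L : Set E) (hL : IsCompact L) (hLΩ : L ⊆ Ω) : ∃ N, ∀ k, x k ∈ L → k < N := by
    obtain ⟨N, hN⟩ := hK L hL hLΩ
    exact ⟨N, fun k hk => not_le.1 fun h => hxK k (hKmono h (hN hk))⟩
  obtain ⟨S, hS⟩ := exists_continuousLinearMap_smul_eval (𝕜 := 𝕜) (F := F) (n := n) hx
    fun k => k / ‖φ k (x k)‖
  obtain ⟨r, hr⟩ := (NormedSpace.isVonNBounded_iff' 𝕜).1 (hB.image S)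
  obtain ⟨k, hk⟩ := exists_nat_gt r
  have hSk : ‖S (φ k) k‖ = k := by
    rw [hS, norm_smul, Real.norm_of_nonneg (by positivity),
      div_mul_cancel₀ _ (norm_ne_zero_iff.2 (hφx k))]
  exact hk.not_ge (hSk ▸ ((S (φ k)).norm_coe_le_norm k).trans (hr _ (mem_image_of_mem S (hφB k))))

variable (𝕜 Ω F n) in
/-- The `i`-th derivative as a continuous linear map from test functions to bounded continuous
functions, extending Mathlib's `ContDiffMapSupportedIn.structureMapCLM`; it is `0` for `i > n`. -/
def iteratedFDerivCLM (i : ℕ) : 𝓓^{n}(Ω, F) →L[𝕜] (E →ᵇ (E [×i]→L[ℝ] F)) :=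
  haveI : IsTopologicalAddGroup (E →ᵇ (E [×i]→L[ℝ] F)) :=
    SeminormedAddCommGroup.toIsTopologicalAddGroup (E := E →ᵇ (E [×i]→L[ℝ] F))
  haveI : LocallyConvexSpace ℝ (E →ᵇ (E [×i]→L[ℝ] F)) :=
    NormedSpace.toLocallyConvexSpace (E := E →ᵇ (E [×i]→L[ℝ] F))
  TestFunction.limitCLM 𝕜 (Ω := Ω) (V := E →ᵇ (E [×i]→L[ℝ] F))
    (fun φ => ContDiffMapSupportedIn.structureMapCLM 𝕜 n i
      (.of_support_subset (K := ⟨tsupport φ, φ.hasCompactSupport⟩) φ.contDiff subset_closure))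
    (fun _ _ => ContDiffMapSupportedIn.structureMapCLM 𝕜 n i)
    fun _ _ _ => by ext1 x; simp only [ContDiffMapSupportedIn.structureMapCLM_apply]; rfl

theorem iteratedFDerivCLM_ofSupportedIn {K : Compacts E} (hK : (K : Set E) ⊆ Ω) (i : ℕ)
    (f : 𝓓^{n}_{K}(E, F)) : iteratedFDerivCLM 𝕜 F Ω n i (TestFunction.ofSupportedIn hK f) =
      ContDiffMapSupportedIn.structureMapCLM 𝕜 n i f := by
  ext1 x
  simp only [iteratedFDerivCLM, TestFunction.limitCLM_apply,
    ContDiffMapSupportedIn.structureMapCLM_apply]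
  rfl

theorem isVonNBounded_preimage_ofSupportedIn {K : Compacts E} (hK : (K : Set E) ⊆ Ω)
    {B : Set 𝓓^{n}(Ω, F)} (hB : IsVonNBounded 𝕜 B) :
    IsVonNBounded 𝕜 (TestFunction.ofSupportedIn hK ⁻¹' B : Set 𝓓^{n}_{K}(E, F)) := by
  rw [(ContDiffMapSupportedIn.withSeminorms 𝕜 _ _ _ _).isVonNBounded_iff_seminorm_bounded]
  intro i
  obtain ⟨r, hr, hrB⟩ := ((NormedSpace.isVonNBounded_iff 𝕜 (E := E →ᵇ (E [×i]→L[ℝ] F))).1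
    (hB.image (iteratedFDerivCLM 𝕜 F Ω n i))).exists_pos_norm_lt
  refine ⟨r, hr, fun f hf => ?_⟩
  rw [ContDiffMapSupportedIn.seminorm_apply, ← iteratedFDerivCLM_ofSupportedIn hK i f]
  exact hrB _ (mem_image_of_mem _ hf)

theorem exists_isVonNBounded_image_ofSupportedIn_eq [FiniteDimensional ℝ E]
    {B : Set 𝓓^{n}(Ω, F)} (hB : IsVonNBounded 𝕜 B) :
    ∃ (K : Compacts E) (hK : (K : Set E) ⊆ Ω) (A : Set 𝓓^{n}_{K}(E, F)),
      IsVonNBounded 𝕜 A ∧ TestFunction.ofSupportedIn hK '' A = B := by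
  obtain ⟨K, hKΩ, hK⟩ := exists_forall_support_subset_of_isVonNBounded hB
  exact ⟨K, hKΩ, TestFunction.ofSupportedIn hKΩ ⁻¹' B, isVonNBounded_preimage_ofSupportedIn hKΩ hB,
    image_preimage_eq_of_subset fun φ hφ => ⟨.of_support_subset φ.contDiff (hK φ hφ), rfl⟩⟩

theorem exists_isVonNBounded_iUnion_smul_of_support_subset {K : Set E} (hK : IsCompact K)
    (hKΩ : K ⊆ Ω) {B : ℕ → Set 𝓓^{n}(Ω, F)} (hB : ∀ m, IsVonNBounded 𝕜 (B m))
    (hBK : ∀ m, ∀ φ ∈ B m, Function.support φ ⊆ K) :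
    ∃ c : ℕ → ℝ, (∀ m, 0 < c m) ∧ IsVonNBounded 𝕜 (⋃ m, (fun φ => (c m : 𝕜) • φ) '' B m) := by
  let K' : Compacts E := ⟨K, hK⟩
  have hK' : (K' : Set E) ⊆ Ω := hKΩ
  obtain ⟨c, hc, hbdd⟩ := exists_isVonNBounded_iUnion_smul
    (ContDiffMapSupportedIn.withSeminorms 𝕜 E F n K')
    fun m => isVonNBounded_preimage_ofSupportedIn hK' (hB m)
  refine ⟨c, hc, (hbdd.image (TestFunction.ofSupportedInCLM 𝕜 hK')).subset ?_⟩
  rintro _ ⟨_, ⟨m, rfl⟩, φ, hφ, rfl⟩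
  let f : 𝓓^{n}_{K'}(E, F) := .of_support_subset φ.contDiff (hBK m φ hφ)
  exact ⟨(c m : 𝕜) • f, mem_iUnion.2 ⟨m, f, hφ, rfl⟩, rfl⟩

end BoundedSets

/-! ### Density of the continuous functions in the strong dual -/

section HahnBanach

variable {𝕜 M W : Type*} [RCLike 𝕜] [AddCommGroup M] [Module 𝕜 M] [NormedAddCommGroup W]
  [NormedSpace 𝕜 W]

theorem exists_continuousLinearMap_apply_eq_of_norm_le (J : M →ₗ[𝕜] W) (u : M →ₗ[𝕜] 𝕜)
    (c : NNReal) (hu : ∀ φ, ‖u φ‖ ≤ c * ‖J φ‖) : ∃ g : W →L[𝕜] 𝕜, ∀ φ, g (J φ) = u φ := by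
  have hker : LinearMap.ker J ≤ LinearMap.ker u := fun φ hφ => by
    have hle := hu φ
    rwa [LinearMap.mem_ker.1 hφ, norm_zero, mul_zero, norm_le_zero_iff] at hle
  let v : Module.Dual 𝕜 (LinearMap.range J) :=
    (LinearMap.ker J).liftQ u hker ∘ₗ J.quotKerEquivRange.symm.toLinearMap
  have hv (φ : M) : v ⟨J φ, LinearMap.mem_range_self J φ⟩ = u φ := by
    simp only [v, LinearMap.comp_apply, LinearEquiv.coe_coe]
    rw [show (⟨J φ, LinearMap.mem_range_self J φ⟩ : LinearMap.range J) =
      J.quotKerEquivRange (Submodule.Quotient.mk φ) from rfl, LinearEquiv.symm_apply_apply,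
      Submodule.liftQ_apply]
  obtain ⟨g, hg, -⟩ := Module.Dual.exists_continuous_extension_of_le_seminorm (LinearMap.range J) v
    (p := c • normSeminorm 𝕜 W) (continuous_norm.const_smul c) (by
      rintro ⟨_, φ, rfl⟩
      exact (hv φ).symm ▸ hu φ)
  exact ⟨g, fun φ => (hg ⟨J φ, _⟩).trans (hv φ)⟩

theorem exists_eq_sum_apply_of_norm_le {ι : Type*} {W : ι → Type*}
    [∀ i, NormedAddCommGroup (W i)] [∀ i, NormedSpace 𝕜 (W i)] (D : ∀ i, M →ₗ[𝕜] W i)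
    {q : ι → Seminorm 𝕜 M} (hq : ∀ i φ, q i φ ≤ ‖D i φ‖) (u : M →ₗ[𝕜] 𝕜) (s : Finset ι)
    (c : NNReal) (hu : ∀ φ, ‖u φ‖ ≤ c * s.sup q φ) :
    ∃ g : ∀ i, W i →L[𝕜] 𝕜, ∀ φ, u φ = ∑ i ∈ s, g i (D i φ) := by
  classical
  let J : M →ₗ[𝕜] ∀ i : s, W i := LinearMap.pi fun i => D i
  obtain ⟨g, hg⟩ := exists_continuousLinearMap_apply_eq_of_norm_le J u c fun φ =>
    (hu φ).trans (mul_le_mul_of_nonneg_left (Seminorm.finset_sup_apply_le (norm_nonneg _)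
      fun i hi => (hq i φ).trans (norm_le_pi_norm (J φ) ⟨i, hi⟩)) c.2)
  refine ⟨fun i => if hi : i ∈ s then
    g.comp (ContinuousLinearMap.single 𝕜 (fun i : s => W i) ⟨i, hi⟩) else 0, fun φ => ?_⟩
  rw [← hg, ← ContinuousLinearMap.sum_comp_single, ← Finset.sum_attach s, Finset.univ_eq_attach]
  refine Finset.sum_congr rfl fun i _ => ?_
  simp only [dif_pos i.2]
  rfl

end HahnBanach

section Structure

variable {𝕜 E F : Type*} [RCLike 𝕜] [NormedAddCommGroup E] [NormedSpace ℝ E]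
  [NormedAddCommGroup F] [NormedSpace ℝ F] [NormedSpace 𝕜 F] [IsScalarTower ℝ 𝕜 F] {n : ℕ∞}
  {K : Compacts E}

theorem exists_eq_sum_apply_structureMapCLM (u : 𝓓^{n}_{K}(E, F) →L[𝕜] 𝕜) :
    ∃ (s : Finset ℕ) (g : ∀ i : ℕ, (E →ᵇ (E [×i]→L[ℝ] F)) →L[𝕜] 𝕜), ∀ f,
      u f = ∑ i ∈ s, g i (ContDiffMapSupportedIn.structureMapCLM 𝕜 n i f) := by
  obtain ⟨s, c, -, hu⟩ := Seminorm.bound_of_continuous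
    (ContDiffMapSupportedIn.withSeminorms 𝕜 E F n K) ((normSeminorm 𝕜 𝕜).comp u.toLinearMap)
    u.continuous.norm
  exact ⟨s, exists_eq_sum_apply_of_norm_le (W := fun i => E →ᵇ (E [×i]→L[ℝ] F))
    (fun i => (ContDiffMapSupportedIn.structureMapCLM 𝕜 n i).toLinearMap)
    (fun i f => (ContDiffMapSupportedIn.seminorm_apply 𝕜 i f).le) u.toLinearMap s c hu⟩

end Structure

section Translates

variable {𝕜 E W : Type*} [RCLike 𝕜] [NormedAddCommGroup E] [NormedAddCommGroup W]

theorem exists_continuous_boundedContinuousFunction_translate {G : E → W} (hG : Continuous G)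
    (hGs : HasCompactSupport G) :
    ∃ Γ : E → (E →ᵇ W), Continuous Γ ∧ ∀ y x, Γ y x = G (x - y) := by
  obtain ⟨C, hC⟩ := hG.bounded_above_of_compact_support hGs
  refine ⟨fun y => .ofNormedAddCommGroup (fun x => G (x - y))
    (hG.comp (continuous_id.sub continuous_const)) C (fun x => hC _), ?_, fun _ _ => rfl⟩
  have hunif := Metric.uniformContinuous_iff.1
    (hG.uniformContinuous_of_tendsto_cocompact hGs.is_zero_at_infty)
  refine Metric.continuous_iff.2 fun y ε hε => ?_
  obtain ⟨δ, hδ, hGδ⟩ := hunif (ε / 2) (half_pos hε)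
  refine ⟨δ, hδ, fun z hz => lt_of_le_of_lt ?_ (half_lt_self hε)⟩
  refine (BoundedContinuousFunction.dist_le (half_pos hε).le).2 fun x => (hGδ ?_).le
  rwa [dist_sub_left]

variable [NormedSpace ℝ W] [NormedSpace 𝕜 W] [CompleteSpace W] [MeasurableSpace E] [BorelSpace E]
  {μ : Measure E} [IsFiniteMeasureOnCompacts μ]

theorem exists_continuous_forall_apply_eq_integral (g : (E →ᵇ W) →L[𝕜] 𝕜) {G : E → W}
    (hG : Continuous G) (hGs : HasCompactSupport G) :
    ∃ f : E → 𝕜, Continuous f ∧ ∀ h : E → 𝕜, Continuous h → HasCompactSupport h →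
      ∀ P : E →ᵇ W, (∀ x, P x = ∫ y, h y • G (x - y) ∂μ) → g P = ∫ y, h y * f y ∂μ := by
  obtain ⟨Γ, hΓ, hΓG⟩ := exists_continuous_boundedContinuousFunction_translate hG hGs
  refine ⟨g ∘ Γ, g.continuous.comp hΓ, fun h hh hhs P hP => ?_⟩
  have hint : Integrable (fun y => h y • Γ y) μ :=
    (hh.smul hΓ).integrable_of_hasCompactSupport hhs.smul_right
  have hPint : P = ∫ y, h y • Γ y ∂μ := by
    ext1 x
    simp_rw [hP, ← hΓG]
    exact (BoundedContinuousFunction.evalCLM 𝕜 x).integral_comp_comm hint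
  rw [hPint, ← g.integral_comp_comm hint]
  simp only [map_smul, smul_eq_mul, Function.comp_apply]

end Translates

section Mollification

variable {𝕜 E F : Type*} [RCLike 𝕜] [NormedAddCommGroup E] [NormedSpace ℝ E]
  [NormedAddCommGroup F] [NormedSpace ℝ F]

theorem dist_iteratedFDeriv_le {φ : E → F} (hφ : ContDiff ℝ ∞ φ) {i : ℕ} {r : ℝ}
    (hr : ∀ x, ‖iteratedFDeriv ℝ (i + 1) φ x‖ ≤ r) (x y : E) :
    dist (iteratedFDeriv ℝ i φ x) (iteratedFDeriv ℝ i φ y) ≤ r * dist x y := by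
  simp_rw [dist_eq_norm]
  refine convex_univ.norm_image_sub_le_of_norm_fderiv_le (𝕜 := ℝ) (fun z _ =>
    (hφ.differentiable_iteratedFDeriv (by exact_mod_cast ENat.natCast_lt_top i)) z)
    (fun z _ => ?_) (mem_univ y) (mem_univ x)
  rw [norm_fderiv_iteratedFDeriv]
  exact hr z

variable [FiniteDimensional ℝ E] [MeasurableSpace E] [BorelSpace E] {μ : Measure E}
  [μ.IsAddHaarMeasure]

theorem iteratedFDeriv_convolution_lsmul [NormedSpace 𝕜 F] [IsScalarTower ℝ 𝕜 F]
    {f : E → 𝕜} (hf : LocallyIntegrable f μ) {g : E → F}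
    (hg : ContDiff ℝ ∞ g) (hgs : HasCompactSupport g) (i : ℕ) :
    iteratedFDeriv ℝ i (f ⋆[ContinuousLinearMap.lsmul ℝ 𝕜, μ] g) =
      f ⋆[ContinuousLinearMap.lsmul ℝ 𝕜, μ] iteratedFDeriv ℝ i g := by
  induction i with
  | zero =>
    rw [iteratedFDeriv_zero_eq_comp, iteratedFDeriv_zero_eq_comp]
    ext1 x
    exact ((continuousMultilinearCurryFin0 ℝ E F).symm.toContinuousLinearEquiv.integral_comp_comm
      fun y => f y • g (x - y)).symm
  | succ i ih =>
    ext1 x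
    have hderiv : HasFDerivAt (f ⋆[ContinuousLinearMap.lsmul ℝ 𝕜, μ] iteratedFDeriv ℝ i g)
        (∫ y, f y • fderiv ℝ (iteratedFDeriv ℝ i g) (x - y) ∂μ) x :=
      (hgs.iteratedFDeriv i).hasFDerivAt_convolution_right (ContinuousLinearMap.lsmul ℝ 𝕜) hf
        (hg.iteratedFDeriv_right (m := 1) (mod_cast le_top)) x
    rw [iteratedFDeriv_succ_eq_comp_left, Function.comp_apply, ih, hderiv.fderiv]
    exact (ContinuousLinearEquiv.integral_comp_comm (𝕜 := ℝ) (E := E →L[ℝ] (E [×i]→L[ℝ] F))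
      (continuousMultilinearCurryLeftEquiv ℝ (fun _ : Fin (i + 1) => E) F
        ).symm.toContinuousLinearEquiv
          fun y => f y • fderiv ℝ (iteratedFDeriv ℝ i g) (x - y)).symm

theorem dist_iteratedFDeriv_normed_convolution_le [CompleteSpace F] {φ : E → F}
    (hφ : ContDiff ℝ ∞ φ) (hφs : HasCompactSupport φ) {i : ℕ} {r : ℝ}
    (hr : ∀ x, ‖iteratedFDeriv ℝ (i + 1) φ x‖ ≤ r)
    (ρ : ContDiffBump (0 : E)) (x : E) :
    dist (iteratedFDeriv ℝ i (ρ.normed μ ⋆[ContinuousLinearMap.lsmul ℝ ℝ, μ] φ) x)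
      (iteratedFDeriv ℝ i φ x) ≤ r * ρ.rOut := by
  have hr0 : 0 ≤ r := (norm_nonneg _).trans (hr x)
  rw [iteratedFDeriv_convolution_lsmul ρ.continuous_normed.locallyIntegrable hφ hφs]
  refine ContDiffBump.dist_normed_convolution_le
    (hφ.continuous_iteratedFDeriv (mod_cast le_top)).aestronglyMeasurable fun y hy => ?_
  exact (dist_iteratedFDeriv_le hφ hr y x).trans
    (mul_le_mul_of_nonneg_left (Metric.mem_ball.1 hy).le hr0)

theorem normed_convolution_eq_convolution_ofReal (ρ : ContDiffBump (0 : E)) (φ : E → 𝕜) :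
    ρ.normed μ ⋆[ContinuousLinearMap.lsmul ℝ ℝ, μ] φ =
      φ ⋆[ContinuousLinearMap.lsmul ℝ 𝕜, μ] fun y => ((ρ.normed μ y : ℝ) : 𝕜) := by
  ext1 x
  rw [convolution_eq_swap]
  simp only [convolution, ContinuousLinearMap.lsmul_apply, RCLike.real_smul_eq_coe_mul,
    smul_eq_mul, mul_comm]

theorem support_normed_convolution_subset_cthickening (ρ : ContDiffBump (0 : E)) {φ : E → F}
    {K : Set E} (hφ : Function.support φ ⊆ K) :
    Function.support (ρ.normed μ ⋆[ContinuousLinearMap.lsmul ℝ ℝ, μ] φ) ⊆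
      Metric.cthickening ρ.rOut K := by
  refine (support_convolution_subset _).trans ?_
  rw [ρ.support_normed_eq]
  rintro _ ⟨y, hy, z, hz, rfl⟩
  refine Metric.mem_cthickening_of_dist_le _ z _ _ (hφ hz) ?_
  simpa [dist_eq_norm] using (mem_ball_zero_iff.1 hy).le

end Mollification

section Density

variable {𝕜 E : Type*} [RCLike 𝕜] [NormedAddCommGroup E] [NormedSpace ℝ E]
  [FiniteDimensional ℝ E] [MeasurableSpace E] [BorelSpace E] (μ : Measure E)
  [μ.IsAddHaarMeasure] {K : Compacts E} {Ω : Opens E}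

theorem exists_continuous_forall_apply_convolution_eq_integral (u : 𝓓_{K}(E, 𝕜) →L[𝕜] 𝕜)
    {g : E → 𝕜} (hg : ContDiff ℝ ∞ g) (hgs : HasCompactSupport g) :
    ∃ f : E → 𝕜, Continuous f ∧ ∀ h : E → 𝕜, Continuous h → HasCompactSupport h →
      ∀ θ : 𝓓_{K}(E, 𝕜), θ = h ⋆[ContinuousLinearMap.lsmul ℝ 𝕜, μ] g →
        u θ = ∫ y, h y * f y ∂μ := by
  obtain ⟨s, v, hv⟩ := exists_eq_sum_apply_structureMapCLM u
  choose f hf hfv using fun i => exists_continuous_forall_apply_eq_integral (μ := μ) (v i)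
    (hg.continuous_iteratedFDeriv (mod_cast le_top)) (hgs.iteratedFDeriv i)
  refine ⟨fun y => ∑ i ∈ s, f i y, continuous_finsetSum _ fun i _ => hf i,
    fun h hh hhs θ hθ => ?_⟩
  have hint (i : ℕ) : Integrable (fun y => h y * f i y) μ :=
    (hh.mul (hf i)).integrable_of_hasCompactSupport hhs.mul_right
  simp_rw [hv, Finset.mul_sum, integral_finsetSum s fun i _ => hint i]
  refine Finset.sum_congr rfl fun i _ => hfv i h hh hhs _ fun x => ?_
  rw [ContDiffMapSupportedIn.structureMapCLM_top_apply, hθ,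
    iteratedFDeriv_convolution_lsmul hh.locallyIntegrable hg hgs]
  rfl

theorem exists_forall_norm_apply_normed_convolution_sub_le (u : 𝓓_{K}(E, 𝕜) →L[𝕜] 𝕜)
    {A : Set 𝓓_{K}(E, 𝕜)} (hA : IsVonNBounded 𝕜 A) {ε : ℝ} (hε : 0 < ε) :
    ∃ δ > 0, ∀ ρ : ContDiffBump (0 : E), ρ.rOut ≤ δ → ∀ φ ∈ A, ∀ θ : 𝓓_{K}(E, 𝕜),
      θ = ρ.normed μ ⋆[ContinuousLinearMap.lsmul ℝ ℝ, μ] φ → ‖u θ - u φ‖ ≤ ε := by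
  have hN := ContDiffMapSupportedIn.withSeminorms 𝕜 E 𝕜 ⊤ K
  obtain ⟨s, c, -, hu⟩ := Seminorm.bound_of_continuous hN
    ((normSeminorm 𝕜 𝕜).comp u.toLinearMap) u.continuous.norm
  choose r hr hrA using hN.isVonNBounded_iff_seminorm_bounded.1 hA
  let R : ℝ := 1 + ∑ i ∈ s, r (i + 1)
  have hR : 0 < R := add_pos_of_pos_of_nonneg one_pos (Finset.sum_nonneg fun i _ => (hr _).le)
  have hrR (i : ℕ) (hi : i ∈ s) : r (i + 1) ≤ R :=
    (Finset.single_le_sum (f := fun i => r (i + 1)) (fun i _ => (hr _).le) hi).trans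
      (le_add_of_nonneg_left zero_le_one)
  refine ⟨ε / ((c + 1) * R), by positivity, fun ρ hρ φ hφ θ hθ => ?_⟩
  have hderiv (i : ℕ) (hi : i ∈ s) : N[𝕜]_{K, i} (θ - φ) ≤ R * ρ.rOut := by
    refine (ContDiffMapSupportedIn.seminorm_top_le_iff 𝕜 (mul_pos hR ρ.rOut_pos).le i _).2
      fun x _ => ?_
    have hbound (y : E) : ‖iteratedFDeriv ℝ (i + 1) φ y‖ ≤ R :=
      (ContDiffMapSupportedIn.norm_iteratedFDeriv_apply_le_seminorm_top 𝕜).trans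
        ((hrA _ φ hφ).le.trans (hrR i hi))
    have hsub : iteratedFDeriv ℝ i (θ - φ : 𝓓_{K}(E, 𝕜)) x =
        iteratedFDeriv ℝ i θ x - iteratedFDeriv ℝ i φ x :=
      iteratedFDeriv_sub_apply (θ.contDiff.of_le (mod_cast le_top)).contDiffAt
        (φ.contDiff.of_le (mod_cast le_top)).contDiffAt
    rw [hsub, ← dist_eq_norm, hθ]
    exact dist_iteratedFDeriv_normed_convolution_le φ.contDiff φ.hasCompactSupport hbound ρ x
  calc ‖u θ - u φ‖ = ‖u (θ - φ)‖ := by rw [map_sub]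
    _ ≤ c * (R * ρ.rOut) := (hu _).trans (mul_le_mul_of_nonneg_left
        (Seminorm.finset_sup_apply_le (mul_pos hR ρ.rOut_pos).le hderiv) c.2)
    _ ≤ (c + 1) * (R * (ε / ((c + 1) * R))) := by
        gcongr
        · exact (mul_pos hR ρ.rOut_pos).le
        · exact (lt_add_one _).le
    _ = ε := by field_simp

theorem exists_continuous_norm_sub_integral_le (u : 𝓓(Ω, 𝕜) →L[𝕜] 𝕜) {B : Set 𝓓(Ω, 𝕜)}
    (hB : IsVonNBounded 𝕜 B) {ε : ℝ} (hε : 0 < ε) :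
    ∃ f : E → 𝕜, Continuous f ∧ ∀ φ ∈ B, ‖∫ x, φ x * f x ∂μ - u φ‖ ≤ ε := by
  obtain ⟨K, hK, hBK⟩ := exists_forall_support_subset_of_isVonNBounded hB
  obtain ⟨δ₀, hδ₀, hδ₀Ω⟩ := K.isCompact.exists_cthickening_subset_open Ω.isOpen hK
  let K' : Compacts E := ⟨Metric.cthickening δ₀ K, K.isCompact.cthickening⟩
  let u' := u.comp (TestFunction.ofSupportedInCLM 𝕜 (K := K') hδ₀Ω)
  obtain ⟨δ, hδ, hδu⟩ := exists_forall_norm_apply_normed_convolution_sub_le μ u'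
    (isVonNBounded_preimage_ofSupportedIn hδ₀Ω hB) hε
  let ρ : ContDiffBump (0 : E) := ⟨min δ δ₀ / 2, min δ δ₀, by positivity,
    half_lt_self (by positivity)⟩
  have hρ : ContDiff ℝ ∞ fun y => ((ρ.normed μ y : ℝ) : 𝕜) :=
    (RCLike.ofRealCLM (K := 𝕜)).contDiff.comp (ρ.contDiff_normed (n := ⊤))
  have hρs : HasCompactSupport fun y => ((ρ.normed μ y : ℝ) : 𝕜) :=
    ρ.hasCompactSupport_normed.comp_left RCLike.ofReal_zero
  obtain ⟨f, hf, hfu⟩ := exists_continuous_forall_apply_convolution_eq_integral μ u' hρ hρs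
  refine ⟨f, hf, fun φ hφ => ?_⟩
  let φ' : 𝓓_{K'}(E, 𝕜) := .of_support_subset φ.contDiff
    ((hBK φ hφ).trans (Metric.self_subset_cthickening _))
  let θ : 𝓓_{K'}(E, 𝕜) := .of_support_subset
    (φ.hasCompactSupport.contDiff_convolution_right (μ := μ) (ContinuousLinearMap.lsmul ℝ ℝ)
      ρ.continuous_normed.locallyIntegrable φ.contDiff)
    ((support_normed_convolution_subset_cthickening ρ (hBK φ hφ)).trans
      (Metric.cthickening_mono (min_le_right _ _) _))
  rw [← hfu φ φ.continuous φ.hasCompactSupport θ (normed_convolution_eq_convolution_ofReal ρ φ)]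
  exact hδu ρ (min_le_left _ _) φ' hφ θ rfl

end Density

section StrongDual

variable {d : ℕ} {X : Opens (Eucl d)}

theorem ofFun_apply {f : Eucl d → ℂ} (hf : ContinuousOn f X) (φ : 𝓓(X, ℂ)) :
    ofFun X f φ = ∫ x, φ x * f x :=
  TestFunction.integralAgainstBilinCLM_eq_integral
    (hf.locallyIntegrableOn X.isOpen.measurableSet)

theorem dense_ofFun : Dense {u : Distr X | ∃ f : Eucl d → ℂ, Continuous f ∧ ofFun X f = u} := by
  refine fun u => mem_closure_of_forall_supSeminorm_le fun B r hr => ?_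
  obtain ⟨f, hf, hfB⟩ := exists_continuous_norm_sub_integral_le volume u B.2 hr
  refine ⟨_, ⟨f, hf, rfl⟩, supSeminorm_le hr.le fun φ hφ => ?_⟩
  rw [sub_apply, ofFun_apply hf.continuousOn]
  exact hfB φ hφ

theorem IsWeightedCompositionOperator.unique {w : Eucl d → ℂ} {ψ : Eucl d → Eucl d}
    {C₁ C₂ : Distr X →L[ℂ] Distr X} (h₁ : IsWeightedCompositionOperator X w ψ C₁)
    (h₂ : IsWeightedCompositionOperator X w ψ C₂) : C₁ = C₂ := by
  refine DFunLike.coe_injective (C₁.continuous.ext_on dense_ofFun C₂.continuous ?_)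
  rintro _ ⟨f, hf, rfl⟩
  rw [h₁ f hf.continuousOn, h₂ f hf.continuousOn]

end StrongDual

/-! ### Smooth embeddings -/

section Embedding

variable {E : Type*} [NormedAddCommGroup E] [NormedSpace ℝ E]

/-- `ψ` restricts to a smooth embedding of `X` into `E`: it is smooth and injective on `X`, with
invertible derivative there. -/
structure IsSmoothEmbeddingOn (ψ : E → E) (X : Set E) : Prop where
  contDiffOn : ContDiffOn ℝ ∞ ψ X
  injOn : InjOn ψ X
  det_fderiv_ne_zero : ∀ x ∈ X, (fderiv ℝ ψ x).det ≠ 0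

variable {ψ : E → E} {X U : Set E}

theorem IsSmoothEmbeddingOn.mono (hψ : IsSmoothEmbeddingOn ψ X) (hU : U ⊆ X) :
    IsSmoothEmbeddingOn ψ U :=
  ⟨hψ.contDiffOn.mono hU, hψ.injOn.mono hU, fun x hx => hψ.det_fderiv_ne_zero x (hU hx)⟩

variable [FiniteDimensional ℝ E]

theorem contDiff_det : ContDiff ℝ ∞ fun A : E →L[ℝ] E => A.det := by
  let b := Module.finBasis ℝ E
  have det_eq (A : E →L[ℝ] E) : A.det = (LinearMap.toMatrix b b A.toLinearMap).det :=
    (LinearMap.det_toMatrix b _).symm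
  simp_rw [det_eq, Matrix.det_apply]
  refine ContDiff.sum fun σ _ => ContDiff.const_smul _ (contDiff_prod fun i _ => ?_)
  let entry : (E →L[ℝ] E) →ₗ[ℝ] ℝ :=
    { toFun A := LinearMap.toMatrix b b A.toLinearMap (σ i) i
      map_add' A B := by simp [LinearMap.toMatrix_apply]
      map_smul' c A := by simp [LinearMap.toMatrix_apply] }
  exact (LinearMap.toContinuousLinearMap entry).contDiff

namespace IsSmoothEmbeddingOn

theorem contDiffOn_abs_det_fderiv (hψ : IsSmoothEmbeddingOn ψ X) (hX : IsOpen X) :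
    ContDiffOn ℝ ∞ (fun x => |(fderiv ℝ ψ x).det|) X := by
  intro x hx
  have hderiv : ContDiffAt ℝ ∞ (fderiv ℝ ψ) x :=
    (hψ.contDiffOn.contDiffAt (hX.mem_nhds hx)).fderiv_right (by simp)
  exact ((contDiff_det.contDiffAt.comp x hderiv).abs
    (hψ.det_fderiv_ne_zero x hx)).contDiffWithinAt

theorem exists_hasStrictFDerivAt_equiv (hψ : IsSmoothEmbeddingOn ψ X) (hX : IsOpen X) {x : E}
    (hx : x ∈ X) : ∃ A : E ≃L[ℝ] E, HasStrictFDerivAt ψ (A : E →L[ℝ] E) x := by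
  refine ⟨(fderiv ℝ ψ x).toContinuousLinearEquivOfDetNeZero (hψ.det_fderiv_ne_zero x hx), ?_⟩
  rw [ContinuousLinearMap.coe_toContinuousLinearEquivOfDetNeZero]
  exact (hψ.contDiffOn.contDiffAt (hX.mem_nhds hx)).hasStrictFDerivAt (by simp)

theorem isOpen_image (hψ : IsSmoothEmbeddingOn ψ X) (hX : IsOpen X) : IsOpen (ψ '' X) := by
  rw [isOpen_iff_mem_nhds]
  rintro _ ⟨x, hx, rfl⟩
  obtain ⟨A, hA⟩ := hψ.exists_hasStrictFDerivAt_equiv hX hx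
  rw [← hA.map_nhds_eq_of_equiv]
  exact image_mem_map (hX.mem_nhds hx)

theorem isOpenMap_domRestrict (hψ : IsSmoothEmbeddingOn ψ X) (hX : IsOpen X) :
    IsOpenMap (X.domRestrict ψ) := by
  intro U hU
  rw [domRestrict_eq, image_comp]
  exact (hψ.mono (Subtype.coe_image_subset X U)).isOpen_image (hX.isOpenMap_subtype_val U hU)

theorem contDiffOn_invFunOn (hψ : IsSmoothEmbeddingOn ψ X) (hX : IsOpen X) :
    ContDiffOn ℝ ∞ (Function.invFunOn ψ X) (ψ '' X) := by
  let e : OpenPartialHomeomorph E E := .ofContinuousOpenRestrict (hψ.injOn.toPartialEquiv ψ X)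
    hψ.contDiffOn.continuousOn (hψ.isOpenMap_domRestrict hX) hX
  intro y hy
  have hy' : e.symm y ∈ X := e.map_target hy
  obtain ⟨A, hA⟩ := hψ.exists_hasStrictFDerivAt_equiv hX hy'
  exact (e.contDiffAt_symm hy hA.hasFDerivAt
    (hψ.contDiffOn.contDiffAt (hX.mem_nhds hy'))).contDiffWithinAt

theorem isCompact_inter_preimage (hψ : IsSmoothEmbeddingOn ψ X) (hX : IsOpen X) {K : Set E}
    (hK : IsCompact K) (hKX : K ⊆ ψ '' X) : IsCompact (X ∩ ψ ⁻¹' K) := by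
  have hinv : LeftInvOn (Function.invFunOn ψ X) ψ X := hψ.injOn.leftInvOn_invFunOn
  have preimage_eq : X ∩ ψ ⁻¹' K = Function.invFunOn ψ X '' K := calc
    X ∩ ψ ⁻¹' K = ψ ⁻¹' K ∩ Function.invFunOn ψ X '' (ψ '' X) := by
      rw [hinv.image_image, inter_comm]
    _ = Function.invFunOn ψ X '' (K ∩ ψ '' X) := hinv.rightInvOn_image.image_inter'.symm
    _ = Function.invFunOn ψ X '' K := by rw [inter_eq_self_of_subset_left hKX]
  rw [preimage_eq]
  exact hK.image_of_continuousOn ((hψ.contDiffOn_invFunOn hX).continuousOn.mono hKX)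

theorem isOpen_iterate_image (hψ : IsSmoothEmbeddingOn ψ X) (hmaps : MapsTo ψ X X)
    (hU : IsOpen U) (hUX : U ⊆ X) (m : ℕ) : IsOpen (ψ^[m] '' U) := by
  induction m generalizing U with
  | zero => simpa
  | succ m ih =>
    rw [Function.iterate_succ, image_comp]
    exact ih ((hψ.mono hUX).isOpen_image hU) (hmaps.mono_left hUX).image_subset

end IsSmoothEmbeddingOn

end Embedding

/-! ### Weighted pull-backs of test functions -/

section PullbackFun

variable {α β R : Type*} [CommSemiring R]

/-- The weighted pull-back `b · (φ ∘ g)` of a function along a map `g` defined on `Y`, extended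
by zero outside `Y`. -/
def pullback (Y : Set α) (b : α → R) (g : α → β) (φ : β → R) : α → R :=
  Y.indicator fun y => b y * φ (g y)

variable {Y : Set α} {b : α → R} {g : α → β}

theorem pullback_apply_of_mem {y : α} (hy : y ∈ Y) (φ : β → R) :
    pullback Y b g φ y = b y * φ (g y) :=
  indicator_of_mem hy _

theorem pullback_apply_of_notMem {y : α} (hy : y ∉ Y) (φ : β → R) : pullback Y b g φ y = 0 :=
  indicator_of_notMem hy _

theorem pullback_add (φ θ : β → R) :
    pullback Y b g (φ + θ) = pullback Y b g φ + pullback Y b g θ := by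
  simp only [pullback, Pi.add_apply, mul_add]
  exact indicator_add Y _ _

theorem pullback_smul (c : R) (φ : β → R) :
    pullback Y b g (c • φ) = c • pullback Y b g φ := by
  simp only [pullback, Pi.smul_apply, mul_smul_comm]
  exact indicator_const_smul Y c _

theorem support_pullback_subset {φ : β → R} {K : Set β} (hφ : Function.support φ ⊆ K) :
    Function.support (pullback Y b g φ) ⊆ Y ∩ g ⁻¹' K := by
  intro y hy
  have hyY : y ∈ Y := mem_of_indicator_ne_zero hy
  rw [Function.mem_support, pullback_apply_of_mem hyY] at hy
  exact ⟨hyY, hφ (right_ne_zero_of_mul hy)⟩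

end PullbackFun

section Pullback

variable {E F : Type*} [NormedAddCommGroup E] [NormedSpace ℝ E] [NormedAddCommGroup F]
  [NormedSpace ℝ F]

theorem contDiff_of_contDiffOn_of_support_subset {G : Type*} [NormedAddCommGroup G]
    [NormedSpace ℝ G] {n : ℕ∞ω} {Y K : Set E} (hY : IsOpen Y) (hK : IsClosed K) (hKY : K ⊆ Y)
    {f : E → G} (hf : ContDiffOn ℝ n f Y) (hfK : Function.support f ⊆ K) : ContDiff ℝ n f := by
  rw [contDiff_iff_contDiffAt]
  intro x
  by_cases hx : x ∈ Y
  · exact hf.contDiffAt (hY.mem_nhds hx)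
  · refine (contDiffAt_const (c := 0)).congr_of_eventuallyEq ?_
    filter_upwards [hK.isOpen_compl.mem_nhds fun h => hx (hKY h)] with y hy
    exact Function.notMem_support.1 fun h => hy (hfK h)

theorem exists_forall_norm_iteratedFDerivWithin_le {Y K : Set E} (hY : UniqueDiffOn ℝ Y)
    (hK : IsCompact K) (hKY : K ⊆ Y) {f : E → F} (hf : ContDiffOn ℝ ∞ f Y) (i : ℕ) :
    ∃ R : ℝ, 1 ≤ R ∧ ∀ j ≤ i, ∀ y ∈ K, ‖iteratedFDerivWithin ℝ j f Y y‖ ≤ R := by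
  choose r hr using fun j : ℕ => hK.exists_bound_of_continuousOn
    ((hf.continuousOn_iteratedFDerivWithin (m := j) (mod_cast le_top) hY).mono hKY)
  obtain ⟨R, hR⟩ := ((Finset.range (i + 1)).image r).bddAbove
  refine ⟨max 1 R, le_max_left _ _, fun j hj y hy => (hr j y hy).trans (le_max_of_le_right ?_)⟩
  exact hR (Finset.mem_coe.2 (Finset.mem_image_of_mem r (Finset.mem_range_succ_iff.2 hj)))

variable {𝕜 : Type*} [RCLike 𝕜]

/-- Leibniz' rule for the product combined with Faà di Bruno's formula for `φ ∘ g`. -/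
theorem exists_forall_norm_iteratedFDerivWithin_mul_comp_le {Y K : Set E}
    (hY : UniqueDiffOn ℝ Y) {b : E → 𝕜} (hb : ContDiffOn ℝ ∞ b Y) {g : E → F}
    (hg : ContDiffOn ℝ ∞ g Y) (hK : IsCompact K) (hKY : K ⊆ Y) (i : ℕ) :
    ∃ C : ℝ, 0 ≤ C ∧ ∀ φ : F → 𝕜, ContDiff ℝ ∞ φ → ∀ M : ℝ,
      (∀ j ≤ i, ∀ x, ‖iteratedFDeriv ℝ j φ x‖ ≤ M) →
        ∀ y ∈ K, ‖iteratedFDerivWithin ℝ i (fun y => b y * φ (g y)) Y y‖ ≤ C * M := by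
  obtain ⟨Rb, hRb1, hRb⟩ := exists_forall_norm_iteratedFDerivWithin_le hY hK hKY hb i
  obtain ⟨Rg, hRg1, hRg⟩ := exists_forall_norm_iteratedFDerivWithin_le hY hK hKY hg i
  refine ⟨∑ j ∈ Finset.range (i + 1), (i.choose j : ℝ) * Rb * ((i - j).factorial * Rg ^ (i - j)),
    by positivity, fun φ hφ M hM y hy => ?_⟩
  have comp_le (k : ℕ) (hk : k ≤ i) :
      ‖iteratedFDerivWithin ℝ k (φ ∘ g) Y y‖ ≤ k.factorial * M * Rg ^ k := by
    refine norm_iteratedFDerivWithin_comp_le (N := ∞) (t := univ) hφ.contDiffOn hg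
      (mod_cast le_top) uniqueDiffOn_univ hY (mapsTo_univ _ _) (hKY hy) (fun l hl => ?_)
      (fun l hl₁ hl => ?_)
    · rw [iteratedFDerivWithin_univ]
      exact hM l (hl.trans hk) _
    · exact (hRg l (hl.trans hk) y hy).trans (le_self_pow₀ hRg1 (by lia))
  rw [Finset.sum_mul]
  refine (norm_iteratedFDerivWithin_mul_le hb (hφ.comp_contDiffOn hg) hY (hKY hy) (n := i)
    (mod_cast le_top)).trans (Finset.sum_le_sum fun j hj => ?_)
  calc _ ≤ (i.choose j : ℝ) * Rb * ((i - j).factorial * M * Rg ^ (i - j)) := by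
        gcongr
        · exact hRb j (Finset.mem_range_succ_iff.1 hj) y hy
        · exact comp_le _ (Nat.sub_le _ _)
    _ = _ := by ring

variable {Y : Set E} {b : E → 𝕜} {g : E → F}

theorem contDiff_pullback (hY : IsOpen Y) (hb : ContDiffOn ℝ ∞ b Y) (hg : ContDiffOn ℝ ∞ g Y)
    {φ : F → 𝕜} (hφ : ContDiff ℝ ∞ φ) {K : Set F} (hφK : Function.support φ ⊆ K)
    (hK : IsClosed (Y ∩ g ⁻¹' K)) : ContDiff ℝ ∞ (pullback Y b g φ) :=
  contDiff_of_contDiffOn_of_support_subset hY hK inter_subset_left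
    ((hb.mul (hφ.comp_contDiffOn hg)).congr fun _ hy => pullback_apply_of_mem hy φ)
    (support_pullback_subset hφK)

theorem exists_continuousLinearMap_eq_pullback_supportedIn {g : E → E} (hY : IsOpen Y)
    (hb : ContDiffOn ℝ ∞ b Y) (hg : ContDiffOn ℝ ∞ g Y) (K K' : Compacts E)
    (hK' : (K' : Set E) = Y ∩ g ⁻¹' K) :
    ∃ T : 𝓓_{K}(E, 𝕜) →L[𝕜] 𝓓_{K'}(E, 𝕜), ∀ f, ⇑(T f) = pullback Y b g f := by
  have hclosed : IsClosed (Y ∩ g ⁻¹' K) := hK' ▸ K'.isCompact.isClosed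
  have hK'Y : (K' : Set E) ⊆ Y := hK' ▸ inter_subset_left
  refine ⟨ContDiffMapSupportedIn.mkCLM 𝕜 (fun f => pullback Y b g f)
    (fun f h y => congrFun (pullback_add f h) y) (fun c f y => congrFun (pullback_smul c f) y)
    (fun f => contDiff_pullback hY hb hg f.contDiff f.support_subset hclosed)
    (fun f => Function.support_subset_iff'.1
      ((support_pullback_subset f.support_subset).trans hK'.superset)) fun i _ => ?_, fun f => rfl⟩
  obtain ⟨C, hC, hbound⟩ := exists_forall_norm_iteratedFDerivWithin_mul_comp_le hY.uniqueDiffOn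
    hb hg K'.isCompact hK'Y i
  refine ⟨Finset.Iic i, C, hC, fun f y hy => ?_⟩
  rw [← iteratedFDerivWithin_of_isOpen i hY (hK'Y hy),
    iteratedFDerivWithin_congr (fun z hz => pullback_apply_of_mem hz f) (hK'Y hy)]
  refine hbound f f.contDiff _ (fun j hj x => ?_) y hy
  exact (ContDiffMapSupportedIn.norm_iteratedFDeriv_apply_le_seminorm_top 𝕜).trans
    (Seminorm.le_finset_sup_apply (Finset.mem_Iic.2 hj))

theorem exists_continuousLinearMap_eq_pullback {g : E → E} {Ω Ω' : Opens E}
    (hY : IsOpen Y) (hYΩ : Y ⊆ Ω') (hb : ContDiffOn ℝ ∞ b Y) (hg : ContDiffOn ℝ ∞ g Y)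
    (hproper : ∀ K : Set E, IsCompact K → K ⊆ Ω → IsCompact (Y ∩ g ⁻¹' K)) :
    ∃ T : 𝓓(Ω, 𝕜) →L[𝕜] 𝓓(Ω', 𝕜), ∀ φ, ⇑(T φ) = pullback Y b g φ := by
  let preim (K : Compacts E) (hK : (K : Set E) ⊆ Ω) : Compacts E :=
    ⟨Y ∩ g ⁻¹' K, hproper K K.isCompact hK⟩
  have preim_subset (K : Compacts E) (hK : (K : Set E) ⊆ Ω) : (preim K hK : Set E) ⊆ Ω' :=
    inter_subset_left.trans hYΩ
  choose T hT using fun (K : Compacts E) (hK : (K : Set E) ⊆ Ω) =>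
    exists_continuousLinearMap_eq_pullback_supportedIn hY hb hg K (preim K hK) rfl
  have hcompact (φ : 𝓓(Ω, 𝕜)) : IsCompact (Y ∩ g ⁻¹' tsupport φ) :=
    hproper _ φ.hasCompactSupport φ.tsupport_subset
  have hsupp (φ : 𝓓(Ω, 𝕜)) : Function.support (pullback Y b g φ) ⊆ Y ∩ g ⁻¹' tsupport φ :=
    support_pullback_subset subset_closure
  let Φ (φ : 𝓓(Ω, 𝕜)) : 𝓓(Ω', 𝕜) :=
    { toFun := pullback Y b g φ
      contDiff' := contDiff_pullback hY hb hg φ.contDiff subset_closure (hcompact φ).isClosed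
      hasCompactSupport' := .of_support_subset_isCompact (hcompact φ) (hsupp φ)
      tsupport_subset' := (closure_minimal (hsupp φ) (hcompact φ).isClosed).trans
        (inter_subset_left.trans hYΩ) }
  exact ⟨TestFunction.limitCLM 𝕜 Φ
    (fun K hK => (TestFunction.ofSupportedInCLM 𝕜 (preim_subset K hK)).comp (T K hK))
    (fun K hK f => DFunLike.coe_injective (hT K hK f).symm), fun φ => rfl⟩

end Pullback

/-! ### The transpose of a weighted composition operator -/

section Transpose

variable {E : Type*} [NormedAddCommGroup E] [NormedSpace ℝ E]

theorem coe_monoCLM {X Y : Opens E} (h : Y ≤ X) (φ : 𝓓(Y, ℂ)) :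
    ((TestFunction.monoCLM ℂ φ : 𝓓(X, ℂ)) : E → ℂ) = φ := by
  simp [h]

theorem monoCLM_monoCLM {X Y Z : Opens E} (hZY : Z ≤ Y) (hYX : Y ≤ X) (φ : 𝓓(Z, ℂ)) :
    (TestFunction.monoCLM ℂ (TestFunction.monoCLM ℂ φ : 𝓓(Y, ℂ)) : 𝓓(X, ℂ)) =
      TestFunction.monoCLM ℂ φ := by
  ext x
  rw [coe_monoCLM hYX, coe_monoCLM hZY, coe_monoCLM (hZY.trans hYX)]

theorem testFunction_eq_zero_of_disjoint {Y Z : Opens E} (hYZ : Disjoint (Y : Set E) Z)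
    (φ : 𝓓(Y ⊓ Z, ℂ)) : φ = 0 := by
  ext x
  exact image_eq_zero_of_notMem_tsupport fun hx =>
    disjoint_left.1 hYZ (φ.tsupport_subset hx).1 (φ.tsupport_subset hx).2

/-- `T` is the transpose of the weighted composition operator with weight `w` and symbol `ψ`: the
change of variables `y = ψ x` turns `∫ φ · w · (f ∘ ψ)` into `∫ T φ · f`. -/
structure IsTranspose (X : Opens E) (w : E → ℂ) (ψ : E → E)
    (T : 𝓓(X, ℂ) →L[ℂ] 𝓓(X, ℂ)) : Prop where
  apply_map : ∀ φ, ∀ x ∈ X, T φ (ψ x) = w x * ((|(fderiv ℝ ψ x).det|⁻¹ : ℝ) : ℂ) * φ x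
  eq_zero : ∀ φ, ∀ y ∉ ψ '' X, T φ y = 0

variable {X : Opens E} {w : E → ℂ} {ψ : E → E} {T : 𝓓(X, ℂ) →L[ℂ] 𝓓(X, ℂ)}

theorem exists_isTranspose [FiniteDimensional ℝ E] (hw : ContDiffOn ℝ ∞ w X)
    (hψ : IsSmoothEmbeddingOn ψ X) (hmaps : MapsTo ψ X X) :
    ∃ T : 𝓓(X, ℂ) →L[ℂ] 𝓓(X, ℂ), IsTranspose X w ψ T := by
  have hinv : LeftInvOn (Function.invFunOn ψ X) ψ X := hψ.injOn.leftInvOn_invFunOn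
  have hinvX : MapsTo (Function.invFunOn ψ X) (ψ '' X) X := fun y hy => Function.invFunOn_mem hy
  have hinvC := hψ.contDiffOn_invFunOn X.isOpen
  let v (x : E) : ℂ := w x * ((|(fderiv ℝ ψ x).det|⁻¹ : ℝ) : ℂ)
  have hv : ContDiffOn ℝ ∞ v X := hw.mul (Complex.ofRealCLM.contDiff.comp_contDiffOn
    ((hψ.contDiffOn_abs_det_fderiv X.isOpen).inv
      fun x hx => abs_ne_zero.2 (hψ.det_fderiv_ne_zero x hx)))
  obtain ⟨T, hT⟩ := exists_continuousLinearMap_eq_pullback (Ω := X) (Ω' := X)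
    (hψ.isOpen_image X.isOpen) hmaps.image_subset (hv.comp hinvC hinvX) hinvC fun K hK hKX => by
      rw [inter_comm, ← hinv.image_inter', inter_eq_self_of_subset_left hKX]
      exact hK.image_of_continuousOn (hψ.contDiffOn.continuousOn.mono hKX)
  refine ⟨T, fun φ x hx => ?_, fun φ y hy => ?_⟩
  · rw [hT, pullback_apply_of_mem (mem_image_of_mem ψ hx), Function.comp_apply, hinv hx]
  · rw [hT, pullback_apply_of_notMem hy]

namespace IsTranspose

theorem support_subset (hT : IsTranspose X w ψ T) (φ : 𝓓(X, ℂ)) :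
    Function.support (T φ) ⊆ ψ '' Function.support φ := by
  intro y hy
  by_cases hyX : y ∈ ψ '' X
  · obtain ⟨x, hx, rfl⟩ := hyX
    rw [Function.mem_support, hT.apply_map φ x hx] at hy
    exact mem_image_of_mem ψ (right_ne_zero_of_mul hy)
  · exact absurd (hT.eq_zero φ y hyX) hy

theorem support_pow_subset (hT : IsTranspose X w ψ T) (m : ℕ) (φ : 𝓓(X, ℂ)) :
    Function.support ((T ^ m) φ) ⊆ ψ^[m] '' Function.support φ := by
  induction m generalizing φ with
  | zero => simp
  | succ m ih =>
    rw [pow_succ, Function.iterate_succ, image_comp]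
    exact (ih (T φ)).trans (image_mono (hT.support_subset φ))

variable [FiniteDimensional ℝ E]

theorem exists_apply_eq (hT : IsTranspose X w ψ T) (hw : ContDiffOn ℝ ∞ w X)
    (hψ : IsSmoothEmbeddingOn ψ X) {O : Opens E} (hOX : O ≤ X) (hwO : ∀ x ∈ O, w x ≠ 0)
    (χ : 𝓓(X, ℂ)) (hχ : tsupport χ ⊆ ψ '' O) : ∃ φ : 𝓓(X, ℂ), T φ = χ ∧ tsupport φ ⊆ O := by
  have hψO : IsSmoothEmbeddingOn ψ O := hψ.mono hOX
  have hdet (x : E) (hx : x ∈ O) : ((|(fderiv ℝ ψ x).det| : ℝ) : ℂ) ≠ 0 :=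
    Complex.ofReal_ne_zero.2 (abs_ne_zero.2 (hψO.det_fderiv_ne_zero x hx))
  let image : Opens E := ⟨ψ '' O, hψO.isOpen_image O.isOpen⟩
  obtain ⟨S, hS⟩ := exists_continuousLinearMap_eq_pullback (Ω := image) (Ω' := O)
    (b := fun x => ((|(fderiv ℝ ψ x).det| : ℝ) : ℂ) * (w x)⁻¹) O.isOpen subset_rfl
    ((Complex.ofRealCLM.contDiff.comp_contDiffOn
      (hψO.contDiffOn_abs_det_fderiv O.isOpen)).mul ((hw.mono hOX).inv hwO)) hψO.contDiffOn
    fun K hK hKO => hψO.isCompact_inter_preimage O.isOpen hK hKO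
  let θ : 𝓓(image, ℂ) := ⟨χ, χ.contDiff, χ.hasCompactSupport, hχ⟩
  have hθ : ⇑θ = χ := rfl
  have hcoe := coe_monoCLM hOX (S θ)
  refine ⟨TestFunction.monoCLM ℂ (S θ), ?_, hcoe ▸ (S θ).tsupport_subset⟩
  ext y
  by_cases hy : y ∈ ψ '' O
  · obtain ⟨x, hx, rfl⟩ := hy
    have hne := hwO x hx
    have hdetx := hdet x hx
    rw [hT.apply_map _ x (hOX hx), hcoe, hS, pullback_apply_of_mem hx, hθ,
      Complex.ofReal_inv]
    field_simp
  · rw [image_eq_zero_of_notMem_tsupport fun h => hy (hχ h)]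
    refine Function.notMem_support.1 fun h => hy (image_mono ?_ (hT.support_subset _ h))
    exact hcoe ▸ subset_closure.trans (S θ).tsupport_subset

theorem exists_pow_apply_eq (hT : IsTranspose X w ψ T) (hw : ContDiffOn ℝ ∞ w X)
    (hψ : IsSmoothEmbeddingOn ψ X) (hmaps : MapsTo ψ X X) (m : ℕ) {U : Set E} (hU : IsOpen U)
    (hUX : U ⊆ X) (hwU : ∀ l < m, ∀ x ∈ U, w (ψ^[l] x) ≠ 0) (χ : 𝓓(X, ℂ))
    (hχ : tsupport χ ⊆ ψ^[m] '' U) : ∃ φ : 𝓓(X, ℂ), (T ^ m) φ = χ ∧ tsupport φ ⊆ U := by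
  induction m generalizing U with
  | zero => exact ⟨χ, rfl, by simpa using hχ⟩
  | succ m ih =>
    rw [Function.iterate_succ, image_comp] at hχ
    obtain ⟨φ₁, rfl, hφ₁⟩ := ih ((hψ.mono hUX).isOpen_image hU)
      (hmaps.mono_left hUX).image_subset
      (forall₂_imp (fun _ _ hwl => forall_mem_image.2 hwl)
        fun l hl => hwU (l + 1) (Nat.succ_lt_succ hl)) hχ
    obtain ⟨φ, rfl, hφ⟩ := hT.exists_apply_eq hw hψ (O := ⟨U, hU⟩) hUX
      (hwU 0 (Nat.succ_pos m)) φ₁ hφ₁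
    exact ⟨φ, by rw [pow_succ]; rfl, hφ⟩

end IsTranspose

end Transpose

section TransposeEucl

variable {d : ℕ} {X : Opens (Eucl d)} {w : Eucl d → ℂ} {ψ : Eucl d → Eucl d}
  {T : 𝓓(X, ℂ) →L[ℂ] 𝓓(X, ℂ)}

theorem IsTranspose.isWeightedCompositionOperator (hT : IsTranspose X w ψ T)
    (hw : ContinuousOn w X) (hψ : IsSmoothEmbeddingOn ψ X) (hmaps : MapsTo ψ X X) :
    IsWeightedCompositionOperator X w ψ (ContinuousLinearMap.precomp ℂ T) := by
  intro f hf
  ext φ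
  have hwf : ContinuousOn (fun x => w x * f (ψ x)) X :=
    hw.mul (hf.comp hψ.contDiffOn.continuousOn hmaps)
  have hderiv (x : Eucl d) (hx : x ∈ X) : HasFDerivWithinAt ψ (fderiv ℝ ψ x) X x :=
    ((hψ.contDiffOn.contDiffAt (X.isOpen.mem_nhds hx)).differentiableAt
      (by simp)).hasFDerivAt.hasFDerivWithinAt
  have hdet (x : Eucl d) (hx : x ∈ X) : ((|(fderiv ℝ ψ x).det| : ℝ) : ℂ) ≠ 0 :=
    Complex.ofReal_ne_zero.2 (abs_ne_zero.2 (hψ.det_fderiv_ne_zero x hx))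
  calc ofFun X f (T φ) = ∫ y, T φ y * f y := ofFun_apply hf _
    _ = ∫ y in ψ '' X, T φ y * f y := by
      refine (setIntegral_eq_integral_of_forall_compl_eq_zero fun y hy => ?_).symm
      rw [hT.eq_zero φ y hy, zero_mul]
    _ = ∫ x in X, |(fderiv ℝ ψ x).det| • (T φ (ψ x) * f (ψ x)) :=
      integral_image_eq_integral_abs_det_fderiv_smul volume X.isOpen.measurableSet hderiv
        hψ.injOn _
    _ = ∫ x in X, φ x * (w x * f (ψ x)) := by
      refine setIntegral_congr_fun X.isOpen.measurableSet fun x hx => ?_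
      have := hdet x hx
      rw [hT.apply_map φ x hx, Complex.real_smul, Complex.ofReal_inv]
      field_simp
    _ = ∫ x, φ x * (w x * f (ψ x)) := by
      refine setIntegral_eq_integral_of_forall_compl_eq_zero fun x hx => ?_
      rw [image_eq_zero_of_notMem_tsupport fun h => hx (φ.tsupport_subset h), zero_mul]
    _ = ofFun X (fun x => w x * f (ψ x)) φ := (ofFun_apply hwf φ).symm

end TransposeEucl

/-! ### Topologizability and stable orbits -/

section Topologizable

variable {d : ℕ} {X : Opens (Eucl d)} {w : Eucl d → ℂ} {ψ : Eucl d → Eucl d}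
  {T : 𝓓(X, ℂ) →L[ℂ] 𝓓(X, ℂ)}

theorem restrictOp_precomp_pow_apply {S : Submodule ℂ (Distr X)}
    (hS : ∀ u ∈ S, ContinuousLinearMap.precomp ℂ T u ∈ S) (m : ℕ) (u : S) (φ : 𝓓(X, ℂ)) :
    ((restrictOp (ContinuousLinearMap.precomp ℂ T) S hS ^ m) u).1 φ = u.1 ((T ^ m) φ) := by
  induction m generalizing u with
  | zero => rfl
  | succ m ih =>
    rw [pow_succ (M := S →L[ℂ] S), pow_succ' T m]
    exact ih _

theorem isTopologizable_restrictOp_precomp_iff {S : Submodule ℂ (Distr X)}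
    (hS : ∀ u ∈ S, ContinuousLinearMap.precomp ℂ T u ∈ S) :
    IsTopologizable (E := S) (restrictOp (ContinuousLinearMap.precomp ℂ T) S hS) ↔
      ∀ A : {A : Set 𝓓(X, ℂ) // IsVonNBounded ℂ A}, ∃ B : {B : Set 𝓓(X, ℂ) // IsVonNBounded ℂ B},
        ∀ m : ℕ, 1 ≤ m → ∃ γ : ℝ, 0 ≤ γ ∧ ∀ u : S, ∀ φ ∈ A.1,
          ‖u.1 ((T ^ m) φ)‖ ≤ γ * supSeminorm B u.1 := by
  have hcont (B : {B : Set 𝓓(X, ℂ) // IsVonNBounded ℂ B}) :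
      Continuous ((supSeminorm B).comp S.subtype : Seminorm ℂ S) :=
    (continuous_supSeminorm B).comp continuous_subtype_val
  constructor
  · intro htop A
    obtain ⟨q, hq, hAq⟩ := htop _ (hcont A)
    obtain ⟨B, c, hqB⟩ := exists_le_smul_supSeminorm q hq
    refine ⟨B, fun m hm => ?_⟩
    obtain ⟨γ, hγ, hγq⟩ := hAq m hm
    refine ⟨γ * c, by positivity, fun u φ hφ => ?_⟩
    calc ‖u.1 ((T ^ m) φ)‖
        = ‖((restrictOp (ContinuousLinearMap.precomp ℂ T) S hS ^ m) u).1 φ‖ := by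
          rw [restrictOp_precomp_pow_apply]
      _ ≤ supSeminorm A ((restrictOp (ContinuousLinearMap.precomp ℂ T) S hS ^ m) u).1 :=
          norm_apply_le_supSeminorm A _ hφ
      _ ≤ γ * q u := hγq u
      _ ≤ γ * (c * supSeminorm B u.1) := by gcongr; exact hqB u
      _ = γ * c * supSeminorm B u.1 := (mul_assoc _ _ _).symm
  · intro h p hp
    obtain ⟨A, c, hpA⟩ := exists_le_smul_supSeminorm p hp
    obtain ⟨B, hAB⟩ := h A
    refine ⟨(supSeminorm B).comp S.subtype, hcont B, fun m hm => ?_⟩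
    obtain ⟨γ, hγ, hγB⟩ := hAB m hm
    refine ⟨c * γ + 1, by positivity, fun u => ?_⟩
    have hA : supSeminorm A ((restrictOp (ContinuousLinearMap.precomp ℂ T) S hS ^ m) u).1 ≤
        γ * supSeminorm B u.1 :=
      supSeminorm_le (by positivity) fun φ hφ => by
        rw [restrictOp_precomp_pow_apply]
        exact hγB u φ hφ
    calc p ((restrictOp (ContinuousLinearMap.precomp ℂ T) S hS ^ m) u)
        ≤ c * (γ * supSeminorm B u.1) := (hpA _).trans (by gcongr)
      _ ≤ (c * γ + 1) * supSeminorm B u.1 := by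
          rw [← mul_assoc]
          gcongr
          exact le_add_of_nonneg_right zero_le_one

theorem IsTranspose.isTopologizable (hT : IsTranspose X w ψ T) {S : Submodule ℂ (Distr X)}
    (hS : ∀ u ∈ S, ContinuousLinearMap.precomp ℂ T u ∈ S) (hψ : HasStableOrbits X ψ) :
    IsTopologizable (E := S) (restrictOp (ContinuousLinearMap.precomp ℂ T) S hS) := by
  refine (isTopologizable_restrictOp_precomp_iff hS).2 fun A => ?_
  obtain ⟨K, hKX, hK⟩ := exists_forall_support_subset_of_isVonNBounded A.2
  obtain ⟨L, hLc, hLX, hL⟩ := hψ K K.isCompact hKX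
  obtain ⟨c, hc, hbdd⟩ := exists_isVonNBounded_iUnion_smul_of_support_subset hLc hLX
    (B := fun m => (T ^ (m + 1)) '' A.1) (fun m => A.2.image (T ^ (m + 1)))
    fun m => forall_mem_image.2 fun φ hφ => (hT.support_pow_subset (m + 1) φ).trans
      ((image_mono (hK φ hφ)).trans (hL (m + 1) m.succ_pos))
  refine ⟨⟨_, hbdd⟩, fun m hm => ⟨(c (m - 1))⁻¹, (inv_pos.2 (hc _)).le, fun u φ hφ => ?_⟩⟩
  obtain ⟨k, rfl⟩ := Nat.exists_eq_add_of_le' hm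
  rw [Nat.add_sub_cancel, le_inv_mul_iff₀ (hc k)]
  calc c k * ‖u.1 ((T ^ (k + 1)) φ)‖ = ‖u.1 ((c k : ℂ) • (T ^ (k + 1)) φ)‖ := by
        rw [map_smul, norm_smul, Complex.norm_real, Real.norm_of_nonneg (hc k).le]
    _ ≤ supSeminorm ⟨_, hbdd⟩ u.1 := norm_apply_le_supSeminorm ⟨_, hbdd⟩ u.1
        (mem_iUnion.2 ⟨k, _, mem_image_of_mem _ hφ, rfl⟩)

end Topologizable

/-! ### Escaping orbits -/

section Gluing

variable {d : ℕ} {G : SheafOfDistributions d} {X Y Z : Opens (Eucl d)}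

theorem SheafOfDistributions.exists_restrict_eq_zero_and_restrict_eq
    (hYZ : Disjoint (Y : Set (Eucl d)) Z) {h : Distr Z} (hh : h ∈ G.obj Z) :
    ∃ v ∈ G.obj (Y ⊔ Z), restrict Y v = 0 ∧ restrict Z v = h := by
  let U : Bool → Opens (Eucl d) := fun b => if b then Y else Z
  let u : (b : Bool) → Distr (U b) := fun b => match b with
    | true => (0 : Distr Y)
    | false => h
  have hu : ∀ b, u b ∈ G.obj (U b)
    | true => (G.obj Y).zero_mem
    | false => hh
  have hcompat : ∀ a b, restrict (U a ⊓ U b) (u a) = restrict (U a ⊓ U b) (u b)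
    | true, true | false, false => rfl
    | true, false => by
      ext φ
      rw [show φ = 0 from testFunction_eq_zero_of_disjoint hYZ φ, map_zero, map_zero]
    | false, true => by
      ext φ
      rw [show φ = 0 from testFunction_eq_zero_of_disjoint hYZ.symm φ, map_zero, map_zero]
  obtain ⟨v, hv, hvu⟩ := G.gluing (Y ⊔ Z) U (by rw [iSup_bool_eq]; rfl) u hu hcompat
  exact ⟨v, hv, hvu true, hvu false⟩

theorem norm_apply_le_of_denseRange {hYX : Y ≤ X} (hdense : DenseRange (G.res hYX))
    (B : {B : Set 𝓓(Y, ℂ) // IsVonNBounded ℂ B}) {χ : 𝓓(Y, ℂ)} {c : ℝ}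
    (hc : ∀ u : G.obj X, ‖u.1 (TestFunction.monoCLM ℂ χ)‖ ≤
      c * supSeminorm ⟨TestFunction.monoCLM ℂ '' B.1, B.2.image (TestFunction.monoCLM ℂ)⟩ u.1)
    (v : G.obj Y) : ‖v.1 χ‖ ≤ c * supSeminorm B v.1 := by
  refine hdense.induction_on (p := fun v : G.obj Y => ‖v.1 χ‖ ≤ c * supSeminorm B v.1) v ?_ ?_
  · exact isClosed_le
      ((ContinuousEvalConst.continuous_eval_const χ).comp continuous_subtype_val).norm
      (continuous_const.mul ((continuous_supSeminorm B).comp continuous_subtype_val))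
  · intro u
    exact (hc u).trans_eq (congrArg (c * ·) (supSeminorm_comp B _ u.1).symm)

/-- By gluing, there is a section over `Y ⊔ Z` vanishing on `Y` but not on `χ`; approximating it
by global sections refutes the estimate. -/
theorem not_forall_norm_apply_le_of_denseRange {hYZX : Y ⊔ Z ≤ X}
    (hdense : DenseRange (G.res hYZX)) (hYZ : Disjoint (Y : Set (Eucl d)) Z) {h : Distr Z}
    (hh : h ∈ G.obj Z) {χ : 𝓓(Z, ℂ)} (hχ : h χ ≠ 0)
    (B : {B : Set 𝓓(Y, ℂ) // IsVonNBounded ℂ B}) (c : ℝ) :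
    ¬ ∀ u : G.obj X, ‖u.1 (TestFunction.monoCLM ℂ χ)‖ ≤
      c * supSeminorm ⟨TestFunction.monoCLM ℂ '' B.1, B.2.image (TestFunction.monoCLM ℂ)⟩ u.1 := by
  intro hc
  obtain ⟨v, hv, hvY, hvZ⟩ := G.exists_restrict_eq_zero_and_restrict_eq hYZ hh
  let B' : {B : Set 𝓓(Y ⊔ Z, ℂ) // IsVonNBounded ℂ B} :=
    ⟨TestFunction.monoCLM ℂ '' B.1, B.2.image (TestFunction.monoCLM ℂ)⟩
  have hBB' : TestFunction.monoCLM ℂ '' B'.1 = (TestFunction.monoCLM ℂ '' B.1 : Set 𝓓(X, ℂ)) := by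
    rw [image_image]
    exact image_congr fun φ _ => monoCLM_monoCLM le_sup_left hYZX φ
  have hle : ‖v (TestFunction.monoCLM ℂ χ)‖ ≤ c * supSeminorm B' v := by
    refine norm_apply_le_of_denseRange hdense B' (fun u => ?_) ⟨v, hv⟩
    simpa only [hBB', monoCLM_monoCLM le_sup_right hYZX] using hc u
  have hvB' : supSeminorm B' v = 0 := by
    rw [← supSeminorm_comp, show v.comp (TestFunction.monoCLM ℂ) = 0 from hvY, map_zero]
  rw [hvB', mul_zero, norm_le_zero_iff] at hle
  exact hχ (by rw [← hvZ]; exact hle)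

end Gluing

namespace IsExhaustion

variable {d : ℕ} {X : Opens (Eucl d)} {Xn : ℕ → Opens (Eucl d)}

theorem exists_subset (h : IsExhaustion X Xn) {K : Set (Eucl d)} (hK : IsCompact K)
    (hKX : K ⊆ X) : ∃ n, K ⊆ Xn n := by
  have hmono : Monotone fun n => (Xn n : Set (Eucl d)) :=
    monotone_nat_of_le_succ fun n => subset_closure.trans (h.closure_subset n)
  refine hK.elim_directed_cover _ (fun n => (Xn n).isOpen) ?_ hmono.directed_le
  rwa [← Opens.coe_iSup, h.iSup_eq]

theorem le (h : IsExhaustion X Xn) (n : ℕ) : Xn n ≤ X :=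
  h.iSup_eq ▸ le_iSup Xn n

theorem exists_image_monoCLM_eq (h : IsExhaustion X Xn)
    (B : {B : Set 𝓓(X, ℂ) // IsVonNBounded ℂ B}) :
    ∃ (n : ℕ) (B' : {B : Set 𝓓(Xn n, ℂ) // IsVonNBounded ℂ B}),
      TestFunction.monoCLM ℂ '' B'.1 = B.1 := by
  obtain ⟨K, hKX, A, hA, hAB⟩ := exists_isVonNBounded_image_ofSupportedIn_eq B.2
  obtain ⟨n, hKn⟩ := h.exists_subset K.isCompact hKX
  refine ⟨n, ⟨_, hA.image (TestFunction.ofSupportedInCLM ℂ hKn)⟩, ?_⟩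
  rw [← hAB, image_image]
  refine image_congr fun f _ => ?_
  ext x
  rw [coe_monoCLM (h.le n)]
  rfl

end IsExhaustion

section Escaping

variable {d : ℕ} {X : Opens (Eucl d)} {w : Eucl d → ℂ} {ψ : Eucl d → Eucl d}
  {T : 𝓓(X, ℂ) →L[ℂ] 𝓓(X, ℂ)} {G : SheafOfDistributions d}

theorem ConditionC.exists_isOpen_forall_ne_zero (hC : ConditionC X w ψ) (hw : ContinuousOn w X)
    (hψ : ContinuousOn ψ X) (hmaps : MapsTo ψ X X) {U : Set (Eucl d)} (hU : IsOpen U)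
    (hUX : U ⊆ X) (hne : U.Nonempty) (m : ℕ) :
    ∃ V ⊆ U, IsOpen V ∧ V.Nonempty ∧ ∀ l < m, ∀ x ∈ V, w (ψ^[l] x) ≠ 0 := by
  induction m with
  | zero => exact ⟨U, subset_rfl, hU, hne, by simp⟩
  | succ m ih =>
    obtain ⟨V, hVU, hV, ⟨x, hx⟩, hwV⟩ := ih
    have hcont : ContinuousOn (fun x => w (ψ^[m] x)) V :=
      (hw.comp (hψ.iterate hmaps m) (hmaps.iterate m)).mono (hVU.trans hUX)
    refine ⟨V ∩ (fun x => w (ψ^[m] x)) ⁻¹' {0}ᶜ, inter_subset_left.trans hVU,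
      hcont.isOpen_inter_preimage hV isOpen_compl_singleton, ?_, fun l hl x hx => ?_⟩
    · obtain ⟨z, hz, hz'⟩ := mem_closure_iff.1 (hC m (hUX (hVU hx))) V hV hx
      exact ⟨z, hz, hz'.2⟩
    · rcases Nat.lt_succ_iff_lt_or_eq.1 hl with h | rfl
      · exact hwV l h x hx.1
      · exact hx.2

theorem IsTranspose.exists_closedBall_forall_exists_pow_apply_eq (hT : IsTranspose X w ψ T)
    (hw : ContDiffOn ℝ ∞ w X) (hψ : IsSmoothEmbeddingOn ψ X) (hmaps : MapsTo ψ X X)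
    (hC : ConditionC X w ψ) {U : Set (Eucl d)} (hU : IsOpen U) (hUX : U ⊆ X) (hne : U.Nonempty)
    (m : ℕ) :
    ∃ (y : Eucl d) (r : ℝ), 0 < r ∧ Metric.closedBall y r ⊆ ψ^[m] '' U ∧
      ∀ χ : 𝓓(X, ℂ), tsupport χ ⊆ Metric.closedBall y r →
        ∃ φ : 𝓓(X, ℂ), (T ^ m) φ = χ ∧ tsupport φ ⊆ U := by
  obtain ⟨V, hVU, hV, ⟨z, hz⟩, hwV⟩ := hC.exists_isOpen_forall_ne_zero hw.continuousOn
    hψ.contDiffOn.continuousOn hmaps hU hUX hne m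
  have hVX : V ⊆ X := hVU.trans hUX
  obtain ⟨r, hr, hrV⟩ := Metric.nhds_basis_closedBall.mem_iff.1
    ((hψ.isOpen_iterate_image hmaps hV hVX m).mem_nhds (mem_image_of_mem _ hz))
  refine ⟨ψ^[m] z, r, hr, hrV.trans (image_mono hVU), fun χ hχ => ?_⟩
  obtain ⟨φ, hφ, hφV⟩ := hT.exists_pow_apply_eq hw hψ hmaps m hV hVX hwV χ (hχ.trans hrV)
  exact ⟨φ, hφ, hφV.trans hVU⟩

theorem IsTranspose.exists_escaping_testFunction (hT : IsTranspose X w ψ T)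
    (hw : ContDiffOn ℝ ∞ w X) (hψ : IsSmoothEmbeddingOn ψ X) (hmaps : MapsTo ψ X X)
    (hB : ConditionB G X) (hC : ConditionC X w ψ) {U : Set (Eucl d)} (hU : IsOpen U)
    (hUX : U ⊆ X) {Y : Set (Eucl d)} (hY : IsClosed Y) {m : ℕ} {x : Eucl d} (hxU : x ∈ U)
    (hxY : ψ^[m] x ∉ Y) :
    ∃ (y : Eucl d) (ε : ℝ) (χ : 𝓓(ball y ε, ℂ)) (φ : 𝓓(X, ℂ)),
      0 < ε ∧ Metric.closedBall y ε ⊆ X \ Y ∧ (∃ h ∈ G.obj (ball y ε), h χ ≠ 0) ∧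
      Function.support φ ⊆ U ∧ (T ^ m) φ = TestFunction.monoCLM ℂ χ := by
  have hcont : ContinuousOn ψ^[m] U := (hψ.contDiffOn.continuousOn.iterate hmaps m).mono hUX
  obtain ⟨y, r, hr, hrU, hsurj⟩ := hT.exists_closedBall_forall_exists_pow_apply_eq hw hψ hmaps hC
    (hcont.isOpen_inter_preimage hU hY.isOpen_compl) (inter_subset_left.trans hUX)
    ⟨x, hxU, hxY⟩ m
  obtain ⟨ε₀, hε₀, hB⟩ := hB
  let ε := min r (ε₀ / 2)
  have hε : 0 < ε := lt_min hr (half_pos hε₀)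
  have hεr : Metric.closedBall y ε ⊆ Metric.closedBall y r :=
    Metric.closedBall_subset_closedBall (min_le_left _ _)
  have hXY : Metric.closedBall y ε ⊆ X \ Y := by
    refine (hεr.trans hrU).trans (image_subset_iff.2 fun z hz => ?_)
    exact ⟨hmaps.iterate m (hUX hz.1), hz.2⟩
  have hballX : ball y ε ≤ X := fun z hz => (hXY (Metric.ball_subset_closedBall hz)).1
  obtain ⟨χ, hχ⟩ := hB ε hε ((min_le_right _ _).trans_lt (half_lt_self hε₀))
  obtain ⟨φ, hφ, hφU⟩ := hsurj (TestFunction.monoCLM ℂ (translate y χ)) (by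
    rw [coe_monoCLM hballX]
    exact (translate y χ).tsupport_subset.trans (Metric.ball_subset_closedBall.trans hεr))
  refine ⟨y, ε, translate y χ, φ, hε, hXY, ?_,
    (subset_tsupport φ).trans (hφU.trans inter_subset_left), hφ⟩
  exact hχ y (hXY (Metric.mem_closedBall_self hε.le)).1
    (Metric.closure_ball_subset_closedBall.trans (hXY.trans sdiff_subset))

theorem IsTranspose.exists_forall_not_norm_apply_pow_le (hT : IsTranspose X w ψ T)
    (hw : ContDiffOn ℝ ∞ w X) (hψ : IsSmoothEmbeddingOn ψ X) (hmaps : MapsTo ψ X X)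
    (hB : ConditionB G X) (hC : ConditionC X w ψ) {U : Set (Eucl d)} (hU : IsOpen U)
    (hUX : U ⊆ X) {Y : Opens (Eucl d)} (hYX : Y ≤ X)
    (hdense : ∀ x ∈ (X : Set (Eucl d)) \ closure Y, ∀ ε : ℝ, 0 < ε →
      closure (Metric.ball x ε) ⊆ (X : Set (Eucl d)) \ Y →
        ∀ h : Y ⊔ ball x ε ≤ X, DenseRange (G.res h))
    {m : ℕ} {x : Eucl d} (hxU : x ∈ U) (hxY : ψ^[m] x ∉ closure (Y : Set (Eucl d))) :
    ∃ φ : 𝓓(X, ℂ), Function.support φ ⊆ U ∧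
      ∀ (B : {B : Set 𝓓(Y, ℂ) // IsVonNBounded ℂ B}) (c : ℝ),
        ¬ ∀ u : G.obj X, ‖u.1 ((T ^ m) φ)‖ ≤ c *
          supSeminorm ⟨TestFunction.monoCLM ℂ '' B.1, B.2.image (TestFunction.monoCLM ℂ)⟩ u.1 := by
  obtain ⟨y, ε, χ, φ, hε, hball, ⟨h, hh, hχ⟩, hφU, hφ⟩ :=
    hT.exists_escaping_testFunction hw hψ hmaps hB hC hU hUX isClosed_closure hxU hxY
  have hle : Y ⊔ ball y ε ≤ X :=
    sup_le hYX fun z hz => (hball (Metric.ball_subset_closedBall hz)).1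
  have hdisj : Disjoint (Y : Set (Eucl d)) (ball y ε) := disjoint_left.2 fun z hz hz' =>
    (hball (Metric.ball_subset_closedBall hz')).2 (subset_closure hz)
  have hrange : DenseRange (G.res hle) :=
    hdense y (hball (Metric.mem_closedBall_self hε.le)) ε hε
      (Metric.closure_ball_subset_closedBall.trans
        (hball.trans (sdiff_subset_sdiff_right subset_closure))) hle
  exact ⟨φ, hφU, hφ ▸ not_forall_norm_apply_le_of_denseRange hrange hdisj hh hχ⟩

/-- If orbits escape, choose test functions `φ n` with support in a fixed compact set such that
some power of `T` moves `φ n` out of `Xn n`. A bounded set containing multiples of all `φ n` would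
have to be dominated by a bounded set living in a single `Xn n`. -/
theorem IsTranspose.hasStableOrbits (hT : IsTranspose X w ψ T) (hw : ContDiffOn ℝ ∞ w X)
    (hψ : IsSmoothEmbeddingOn ψ X) (hmaps : MapsTo ψ X X)
    {hG : ∀ u ∈ G.obj X, ContinuousLinearMap.precomp ℂ T u ∈ G.obj X}
    (hA : ConditionA G X) (hB : ConditionB G X) (hC : ConditionC X w ψ)
    (htop : IsTopologizable (E := G.obj X)
      (restrictOp (ContinuousLinearMap.precomp ℂ T) (G.obj X) hG)) :
    HasStableOrbits X ψ := by
  obtain ⟨Xn, hXn, hdense⟩ := hA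
  intro K hK hKX
  by_contra! hesc
  obtain ⟨L, hL, hKL, hLX⟩ := exists_compact_between hK X.isOpen hKX
  have hseq (n : ℕ) : ∃ m, 1 ≤ m ∧ ∃ φ : 𝓓(X, ℂ), Function.support φ ⊆ interior L ∧
      ∀ (B : {B : Set 𝓓(Xn n, ℂ) // IsVonNBounded ℂ B}) (c : ℝ),
        ¬ ∀ u : G.obj X, ‖u.1 ((T ^ m) φ)‖ ≤ c *
          supSeminorm ⟨TestFunction.monoCLM ℂ '' B.1, B.2.image (TestFunction.monoCLM ℂ)⟩ u.1 := by
    obtain ⟨m, hm, hmK⟩ := hesc _ (hXn.isCompact_closure n)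
      ((hXn.closure_subset n).trans (hXn.le (n + 1)))
    obtain ⟨_, ⟨x, hx, rfl⟩, hxn⟩ := not_subset.1 hmK
    exact ⟨m, hm, hT.exists_forall_not_norm_apply_pow_le hw hψ hmaps hB hC isOpen_interior
      (interior_subset.trans hLX) (hXn.le n) (hdense n) (hKL hx) hxn⟩
  choose m hm φ hφL hφ using hseq
  obtain ⟨a, ha, hbdd⟩ := exists_isVonNBounded_iUnion_smul_of_support_subset (𝕜 := ℂ) hL hLX
    (B := fun n => {φ n}) (fun n => isVonNBounded_singleton (φ n))
    fun n => forall_eq.2 ((hφL n).trans interior_subset)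
  obtain ⟨⟨_, hB⟩, hγ⟩ := (isTopologizable_restrictOp_precomp_iff hG).1 htop ⟨_, hbdd⟩
  obtain ⟨n, B, rfl⟩ := hXn.exists_image_monoCLM_eq ⟨_, hB⟩
  obtain ⟨γ, -, hγB⟩ := hγ (m n) (hm n)
  refine hφ n B ((a n)⁻¹ * γ) fun u => ?_
  have hu := hγB u ((a n : ℂ) • φ n) (mem_iUnion.2 ⟨n, mem_image_of_mem _ rfl⟩)
  rw [map_smul, map_smul, norm_smul, Complex.norm_real, Real.norm_of_nonneg (ha n).le] at hu
  rwa [mul_assoc, le_inv_mul_iff₀ (ha n)]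

end Escaping

end DistSheaf

end

open DistSheaf in
theorem mainTheorem1 {d : ℕ} (X : Opens (Eucl d)) (w : Eucl d → ℂ) (hw : ContDiffOn ℝ ∞ w X)
    (ψ : Eucl d → Eucl d) (hψmaps : Set.MapsTo ψ X X) (hψ : ContDiffOn ℝ ∞ ψ X)
    (hψinj : Set.InjOn ψ X) (hψdet : ∀ x ∈ X, (fderiv ℝ ψ x).det ≠ 0) :
    (∃! C : Distr X →L[ℂ] Distr X, IsWeightedCompositionOperator X w ψ C) ∧
    ∀ C : Distr X →L[ℂ] Distr X, IsWeightedCompositionOperator X w ψ C →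
      ∀ (G : SheafOfDistributions d) (hG : ∀ u ∈ G.obj X, C u ∈ G.obj X),
        ConditionA G X → ConditionB G X → ConditionC X w ψ →
          (IsTopologizable (E := G.obj X) (restrictOp C (G.obj X) hG) ↔ HasStableOrbits X ψ) := by
  have hemb : IsSmoothEmbeddingOn ψ X := ⟨hψ, hψinj, hψdet⟩
  obtain ⟨T, hT⟩ := exists_isTranspose hw hemb hψmaps
  have hTC := hT.isWeightedCompositionOperator hw.continuousOn hemb hψmaps
  refine ⟨⟨_, hTC, fun C hC => hC.unique hTC⟩, fun C hC G hG hA hB hC' => ?_⟩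
  obtain rfl := hC.unique hTC
  exact ⟨hT.hasStableOrbits hw hemb hψmaps hA hB hC', hT.isTopologizable hG⟩
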